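/- Let $n\ge 1$, let $K_w,K_v\in\mathbb{R}^{n\times n}$ be symmetric positive definite, and let $P\ge 0$. For a strictly lower triangular matrix $B\in\mathbb{R}^{n\times n}$ and a symmetric positive semidefinite matrix $K_s\in\mathbb{R}^{n\times n}$ let $S^n\sim N(0,K_s)$ (message vector), $W^n\sim N(0,K_w)$ (channel noise) and $V^n\sim N(0,K_v)$ (feedback noise) be independent random vectors, and let $$X^n=S^n+B(W^n+V^n),\qquad Y^n=X^n+W^n$$ be the input and the output of the Gaussian channel with additive Gaussian noise feedback under linear feedback coding. Let $K_x$ be the covariance matrix of $X^n$, so that $\operatorname{tr}K_x=\operatorname{tr}\bigl(K_s+B(K_w+K_v)B^T\bigr)$. Logarithms are to base $2$ and information is measured in bits. Write $$I(X^n\to Y^n\mid V^n)=\sum_{i=1}^n I(X^i;Y_i\mid Y^{i-1},V^n)$$ for the conditional directed information, where $X^i=(X_1,\dots,X_i)$ and $Y^{i-1}=(Y_1,\dots,Y_{i-1})$. Let $$R_{n,\max}(P)=\max_{B,K_s}\ \tfrac1n I(S^n;Y^n),\qquad C_n(P)=\max_{B,K_s}\ \tfrac1n I(X^n\to Y^n\mid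 V^n),$$ both maxima being over all strictly lower triangular $B$ and all $K_s\ge 0$ with $\operatorname{tr}K_x\le nP$; $R_{n,\max}(P)$ is the largest $n$-block achievable rate of the scheme. Consider also the program in $(H,B)\in\mathbb{R}^{n\times n}\times\mathbb{R}^{n\times n}$ $$\begin{aligned} \text{maximize}\quad & \frac1{2n}\log\det\begin{bmatrix}K_v^{-1}&B^T\\ B&H\end{bmatrix}-\frac1{2n}\log\det(K_v^{-1}K_w)\\ \text{subject to}\quad & \operatorname{tr}(H-K_wB^T-BK_w-K_w)\le nP,\\ & \begin{bmatrix}H& I+B& B\\ I+B^T&K_w^{-1}&0\\ B^T&0&K_v^{-1}\end{bmatrix}\ge 0,\\ & B\ \text{strictly lower triangular}, \end{aligned}$$ where $\ge 0$ means symmetric positive semidefinite. Then: 1. This is a convex optimization problem: its feasible set is convex, the $2\times2$ block matrix in the objective is positive definite at every feasible point, and the objective is concave on the feasible set. 2. The maxima $R_{n,\max}(P)$ and $C_n(P)$ and the maximum of the program are attained and finite, $C_n(P)$ equals the optimal value of the program, and $$R_{n,\max}(P)\le C_n(P).$$ -/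

import Mathlib

open MeasureTheory ProbabilityTheory InformationTheory Matrix
open scoped ENNReal NNReal

noncomputable section

namespace NoisyFeedback

section Information

variable {Ω α β γ : Type*} [MeasurableSpace Ω] [MeasurableSpace α] [MeasurableSpace β]
  [MeasurableSpace γ]

/-- Mutual information `I(X; Y)` in bits: the relative entropy of the joint law with respect to the
product of the marginal laws. -/
def mutualInfo (X : Ω → α) (Y : Ω → β) (μ : Measure Ω) : ℝ≥0∞ :=
  klDiv (μ.map fun ω => (X ω, Y ω)) ((μ.map X).prod (μ.map Y)) / ENNReal.ofReal (Real.log 2)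

/-- Conditional mutual information `I(X; Y | Z)` in bits: the relative entropy of the joint law
`P_{ZXY}` with respect to `P_Z ⊗ (P_{X|Z} × P_{Y|Z})`. -/
def condMutualInfo [StandardBorelSpace α] [Nonempty α] [StandardBorelSpace β] [Nonempty β]
    (X : Ω → α) (Y : Ω → β) (Z : Ω → γ) (μ : Measure Ω) [IsFiniteMeasure μ] : ℝ≥0∞ :=
  klDiv (μ.map fun ω => (Z ω, X ω, Y ω))
    ((μ.map Z) ⊗ₘ (condDistrib X Z μ ×ₖ condDistrib Y Z μ)) / ENNReal.ofReal (Real.log 2)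

/-- Conditional directed information
`I(X^n → Y^n | V) = ∑_i I(X^i; Y_i | Y^{i-1}, V)` in bits. -/
def condDirectedInfo {n : ℕ} (X Y : Ω → Fin n → ℝ) (V : Ω → γ) (μ : Measure Ω)
    [IsFiniteMeasure μ] : ℝ≥0∞ :=
  ∑ i : Fin n, condMutualInfo
    (fun ω (j : {j : Fin n // j ≤ i}) => X ω j)
    (fun ω => Y ω i)
    (fun ω => ((fun j : {j : Fin n // j < i} => Y ω j), V ω)) μ

end Information

variable {n : ℕ}

/-- Realizations `(s, w, v)` of the message vector, the forward noise and the feedback noise. -/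
abbrev Sample (n : ℕ) : Type :=
  EuclideanSpace ℝ (Fin n) × EuclideanSpace ℝ (Fin n) × EuclideanSpace ℝ (Fin n)

/-- The joint law of the independent vectors `s ∼ N(0, Ks)`, `w ∼ N(0, Kw)`, `v ∼ N(0, Kv)`. -/
def law (Ks Kw Kv : Matrix (Fin n) (Fin n) ℝ) : Measure (Sample n) :=
  (multivariateGaussian 0 Ks).prod ((multivariateGaussian 0 Kw).prod (multivariateGaussian 0 Kv))

instance (Ks Kw Kv : Matrix (Fin n) (Fin n) ℝ) : IsProbabilityMeasure (law Ks Kw Kv) := by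
  unfold law
  infer_instance

/-- The message vector `s`. -/
def message (ω : Sample n) : Fin n → ℝ := ω.1.ofLp

/-- The forward noise `w`. -/
def forwardNoise (ω : Sample n) : Fin n → ℝ := ω.2.1.ofLp

/-- The feedback noise `v`. -/
def feedbackNoise (ω : Sample n) : Fin n → ℝ := ω.2.2.ofLp

/-- The channel input `x = s + B (w + v)`. -/
def input (B : Matrix (Fin n) (Fin n) ℝ) (ω : Sample n) : Fin n → ℝ :=
  message ω + B *ᵥ (forwardNoise ω + feedbackNoise ω)

/-- The channel output `y = s + B (w + v) + w`. -/
def output (B : Matrix (Fin n) (Fin n) ℝ) (ω : Sample n) : Fin n → ℝ :=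
  input B ω + forwardNoise ω

/-- The covariance matrix `K_x` of the channel input. -/
def inputCov (B Ks Kw Kv : Matrix (Fin n) (Fin n) ℝ) : Matrix (Fin n) (Fin n) ℝ :=
  Matrix.of fun i j => covariance (fun ω => input B ω i) (fun ω => input B ω j) (law Ks Kw Kv)

def IsStrictlyLower (B : Matrix (Fin n) (Fin n) ℝ) : Prop :=
  ∀ i j, i ≤ j → B i j = 0

/-- The `n`-block rate `(1/n) I(S^n; Y^n)` of the linear scheme `(B, Ks)`. -/
def rate (B Ks Kw Kv : Matrix (Fin n) (Fin n) ℝ) : ℝ≥0∞ :=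
  mutualInfo message (output B) (law Ks Kw Kv) / n

/-- `(1/n) I(X^n → Y^n | V^n)` for the linear scheme `(B, Ks)`. -/
def directedRate (B Ks Kw Kv : Matrix (Fin n) (Fin n) ℝ) : ℝ≥0∞ :=
  condDirectedInfo (input B) (output B) feedbackNoise (law Ks Kw Kv) / n

/-- The rates of all linear schemes `(B, Ks)` that meet the power constraint
`tr (Ks + B (Kw + Kv) Bᵀ) ≤ n P`. -/
def achievableRates (Kw Kv : Matrix (Fin n) (Fin n) ℝ) (P : ℝ) : Set ℝ≥0∞ :=
  {r | ∃ B Ks : Matrix (Fin n) (Fin n) ℝ, IsStrictlyLower B ∧ Ks.PosSemidef ∧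
    (Ks + B * (Kw + Kv) * Bᵀ).trace ≤ n * P ∧ r = rate B Ks Kw Kv}

/-- The values of `(1/n) I(X^n → Y^n | V^n)` over all `(B, Ks)` with `tr K_x ≤ n P`. -/
def directedRates (Kw Kv : Matrix (Fin n) (Fin n) ℝ) (P : ℝ) : Set ℝ≥0∞ :=
  {r | ∃ B Ks : Matrix (Fin n) (Fin n) ℝ, IsStrictlyLower B ∧ Ks.PosSemidef ∧
    (inputCov B Ks Kw Kv).trace ≤ n * P ∧ r = directedRate B Ks Kw Kv}

/-- The matrix `[Kv⁻¹, Bᵀ; B, H]`. -/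
def objectiveBlock (Kv H B : Matrix (Fin n) (Fin n) ℝ) :
    Matrix (Fin n ⊕ Fin n) (Fin n ⊕ Fin n) ℝ :=
  fromBlocks Kv⁻¹ Bᵀ B H

/-- The matrix `[H, I + B, B; I + Bᵀ, Kw⁻¹, 0; Bᵀ, 0, Kv⁻¹]`. -/
def constraintBlock (Kw Kv H B : Matrix (Fin n) (Fin n) ℝ) :
    Matrix (Fin n ⊕ Fin n ⊕ Fin n) (Fin n ⊕ Fin n ⊕ Fin n) ℝ :=
  fromBlocks H (fromCols (1 + B) B) (fromRows (1 + Bᵀ) Bᵀ) (fromBlocks Kw⁻¹ 0 0 Kv⁻¹)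

/-- The feasible pairs `(H, B)` of the max-det program. -/
def feasible (Kw Kv : Matrix (Fin n) (Fin n) ℝ) (P : ℝ) :
    Set (Matrix (Fin n) (Fin n) ℝ × Matrix (Fin n) (Fin n) ℝ) :=
  {p | (p.1 - Kw * p.2ᵀ - p.2 * Kw - Kw).trace ≤ n * P ∧
    (constraintBlock Kw Kv p.1 p.2).PosSemidef ∧ IsStrictlyLower p.2}

/-- The objective of the max-det program. -/
def objective (Kw Kv : Matrix (Fin n) (Fin n) ℝ)
    (p : Matrix (Fin n) (Fin n) ℝ × Matrix (Fin n) (Fin n) ℝ) : ℝ :=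
  1 / (2 * n) * Real.logb 2 (objectiveBlock Kv p.1 p.2).det
    - 1 / (2 * n) * Real.logb 2 (Kv⁻¹ * Kw).det

end NoisyFeedback

end

/-! Everything reduces to log-determinants. With `N = (1 + B) Kw (1 + B)ᵀ + B Kv Bᵀ`, the output is
the message plus independent noise of covariance `N`, so `n * rate` is half of `log (det (Ks + N) /
det N)` (`rate_eq`). Given the feedback noise, the output has covariance `Ks + (1 + B) Kw (1 + B)ᵀ`.
The directed information is a sum over `i` of entropy differences: the innovation of `y - B v`
against that of `w`, since `xⁱ` and `yⁱ⁻¹` reveal `wⁱ⁻¹`. The innovation variances multiply up to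
determinants, so `n * directedRate` is half of `log (det (Ks + (1 + B) Kw (1 + B)ᵀ) / det Kw)`
(`condMutualInfo_input_output`, `directedRate_eq`).

As `1 + B` is unit triangular, `det Kw = det ((1 + B) Kw (1 + B)ᵀ)`. The two rates are thus the same
ratio `det (Ks + X) / det X`, with and without the extra noise `B Kv Bᵀ` in `X`; more noise lowers
it (`det_add_div_det_antitone`), whence `R ≤ C`.

Put `H = Ks + N`. Schur complements turn the large block constraint into `Ks ≥ 0` and the objective
determinant into `det Kv⁻¹` times that of the conditional output covariance, so the program is the
maximization of the directed rate (`mem_feasible_iff`, `objective_eq`). Its blocks are affine in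
`(H, B)` and `log det` is concave, hence convexity. The maxima are attained because the admissible
schemes form a compact set (`isCompact_schemes`) on which both formulas are continuous. -/

noncomputable section

namespace NoisyFeedback

/-! ### Concavity and monotonicity of the determinant on positive definite matrices. -/

section LogDet

variable {ι : Type*} [Fintype ι] [DecidableEq ι]

lemma log_det_le_trace_sub_card {X : Matrix ι ι ℝ} (hX : X.PosDef) :
    Real.log X.det ≤ X.trace - Fintype.card ι := by
  have hdet : X.det = ∏ i, hX.isHermitian.eigenvalues i := by
    simpa using hX.isHermitian.det_eq_prod_eigenvalues
  have htr : X.trace = ∑ i, hX.isHermitian.eigenvalues i := by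
    simpa using hX.isHermitian.trace_eq_sum_eigenvalues
  rw [hdet, htr, Real.log_prod fun i _ => (hX.eigenvalues_pos i).ne']
  calc ∑ i, Real.log (hX.isHermitian.eigenvalues i)
      ≤ ∑ i, (hX.isHermitian.eigenvalues i - 1) :=
        Finset.sum_le_sum fun i _ => Real.log_le_sub_one_of_pos (hX.eigenvalues_pos i)
    _ = _ := by simp

open scoped MatrixOrder in
lemma exists_mul_transpose {X : Matrix ι ι ℝ} (hX : X.PosSemidef) :
    ∃ G : Matrix ι ι ℝ, X = G * Gᵀ := by
  obtain ⟨G, rfl⟩ := CStarAlgebra.nonneg_iff_eq_star_mul_self.mp hX.nonneg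
  exact ⟨Gᵀ, by simp [star_eq_conjTranspose]⟩

lemma exists_isUnit_mul_transpose {X : Matrix ι ι ℝ} (hX : X.PosDef) :
    ∃ G : Matrix ι ι ℝ, IsUnit G ∧ X = G * Gᵀ := by
  obtain ⟨G, rfl⟩ := exists_mul_transpose hX.posSemidef
  have h := hX.det_pos.ne'
  rw [det_mul] at h
  exact ⟨G, (isUnit_iff_isUnit_det _).2 (left_ne_zero_of_mul h).isUnit, rfl⟩

/-- The tangent inequality for `log det` on positive definite matrices. -/
lemma log_det_le_add_trace {X Y : Matrix ι ι ℝ} (hX : X.PosDef) (hY : Y.PosDef) :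
    Real.log X.det ≤ Real.log Y.det + (Y⁻¹ * (X - Y)).trace := by
  -- Congruence by a factor of `Y⁻¹` reduces to the case `Y = 1`, which is `log x ≤ x - 1` summed
  -- over the eigenvalues.
  obtain ⟨G, hG, hYG⟩ := exists_isUnit_mul_transpose hY.inv
  have hpd : (Gᵀ * X * G).PosDef := by
    have := hX.conjTranspose_mul_mul_same (B := G) (mulVec_injective_of_isUnit hG)
    simpa using this
  have h := log_det_le_trace_sub_card hpd
  have hdet : (Gᵀ * X * G).det = (Y.det)⁻¹ * X.det := by
    rw [← Ring.inverse_eq_inv', ← det_nonsing_inv, hYG, det_mul, det_mul, det_mul]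
    ring
  have htr : (Gᵀ * X * G).trace = (Y⁻¹ * X).trace := by
    rw [hYG, trace_mul_cycle]
  have hone : (Y⁻¹ * Y).trace = Fintype.card ι := by
    rw [nonsing_inv_mul _ ((isUnit_iff_isUnit_det _).1 hY.isUnit), trace_one]
  rw [hdet, htr, Real.log_mul (inv_ne_zero hY.det_pos.ne') hX.det_pos.ne', Real.log_inv] at h
  rw [Matrix.mul_sub, trace_sub, hone]
  linarith

lemma trace_mul_nonneg {X Y : Matrix ι ι ℝ} (hX : X.PosSemidef) (hY : Y.PosSemidef) :
    0 ≤ (X * Y).trace := by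
  obtain ⟨G, rfl⟩ := exists_mul_transpose hX
  have h := (hY.conjTranspose_mul_mul_same G).trace_nonneg
  rwa [conjTranspose_eq_transpose_of_trivial, trace_mul_cycle] at h

/-- The tangent inequality at `Z = aX + bY` is applied to `X` and to `Y`; in the weighted average
the trace terms cancel. -/
lemma concaveOn_log_det :
    ConcaveOn ℝ {X : Matrix ι ι ℝ | X.PosDef} fun X => Real.log X.det := by
  have hconv : Convex ℝ {X : Matrix ι ι ℝ | X.PosDef} := by
    intro X hX Y hY a b ha hb hab
    rcases ha.eq_or_lt with rfl | ha
    · obtain rfl : b = 1 := by linarith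
      simpa using hY
    · exact (PosDef.smul hX ha).add_posSemidef (PosSemidef.smul hY.posSemidef hb)
  refine ⟨hconv, fun X hX Y hY a b ha hb hab => ?_⟩
  have hZ := hconv hX hY ha hb hab
  set Z := a • X + b • Y with hZdef
  have h1 := mul_le_mul_of_nonneg_left (log_det_le_add_trace hX hZ) ha
  have h2 := mul_le_mul_of_nonneg_left (log_det_le_add_trace hY hZ) hb
  have h3 : a * (Z⁻¹ * (X - Z)).trace + b * (Z⁻¹ * (Y - Z)).trace = 0 := by
    have : a • (X - Z) + b • (Y - Z) = 0 := by
      have : a • (X - Z) + b • (Y - Z) = Z - (a + b) • Z := by rw [hZdef]; module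
      rw [this, hab, one_smul, sub_self]
    have h := congrArg (fun W => (Z⁻¹ * W).trace) this
    simpa [Matrix.mul_add] using h
  have h4 : a * Real.log Z.det + b * Real.log Z.det = Real.log Z.det := by
    rw [← add_mul, hab, one_mul]
  simp only [smul_eq_mul]
  linarith

lemma det_le_det_of_posSemidef_sub {X Y : Matrix ι ι ℝ} (hX : X.PosDef)
    (h : (Y - X).PosSemidef) : X.det ≤ Y.det := by
  have hY : Y.PosDef := by simpa using hX.add_posSemidef h
  have h1 := log_det_le_add_trace hX hY
  have h2 := trace_mul_nonneg hY.inv.posSemidef h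
  rw [← neg_sub Y X, Matrix.mul_neg, trace_neg] at h1
  exact (Real.log_le_log_iff hX.det_pos hY.det_pos).1 (by linarith)

/-- `Y - X` and `X⁻¹ - Y⁻¹` are the two Schur complements of the block matrix `[Y, 1; 1, X⁻¹]`. -/
lemma posSemidef_inv_sub_inv {X Y : Matrix ι ι ℝ} (hX : X.PosDef) (h : (Y - X).PosSemidef) :
    (X⁻¹ - Y⁻¹).PosSemidef := by
  have hY : Y.PosDef := by simpa using hX.add_posSemidef h
  have := hX.inv.isUnit.invertible
  have := hY.isUnit.invertible
  have := hX.isUnit.invertible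
  have h1 := (PosDef.fromBlocks₂₂ Y 1 hX.inv).2 (by simpa using h)
  simpa using (PosDef.fromBlocks₁₁ 1 X⁻¹ hY).1 h1

/-- The ratio `det (X + S) / det X` is antitone in the positive definite matrix `X`. -/
lemma det_add_div_det_antitone {X D S : Matrix ι ι ℝ} (hX : X.PosDef) (hD : D.PosSemidef)
    (hS : S.PosSemidef) :
    (S + (X + D)).det / (X + D).det ≤ (S + X).det / X.det := by
  have hXD := hX.add_posSemidef hD
  have hXS := hX.posSemidef_add hS
  rw [div_le_div_iff₀ hXD.det_pos hX.det_pos]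
  -- By the matrix determinant lemma, adding `D = C Cᵀ` multiplies `det X` by `det (1 + Cᵀ X⁻¹ C)`.
  -- The same factor for `S + X` is smaller, because inversion is antitone.
  obtain ⟨C, rfl⟩ := exists_mul_transpose hD
  have hu : IsUnit X.det := hX.det_pos.ne'.isUnit
  have hu' : IsUnit (S + X).det := hXS.det_pos.ne'.isUnit
  rw [← add_assoc, det_add_mul _ _ hu, det_add_mul _ _ hu']
  have hle : (1 + Cᵀ * (S + X)⁻¹ * C).det ≤ (1 + Cᵀ * X⁻¹ * C).det := by
    refine det_le_det_of_posSemidef_sub ?_ ?_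
    · have := hXS.inv.posSemidef.conjTranspose_mul_mul_same C
      exact PosDef.one.add_posSemidef (by simpa using this)
    · have := (posSemidef_inv_sub_inv (Y := S + X) hX
        (by simpa using hS)).conjTranspose_mul_mul_same C
      rw [conjTranspose_eq_transpose_of_trivial, Matrix.mul_sub, Matrix.sub_mul] at this
      simpa using this
  have := mul_le_mul_of_nonneg_left hle (mul_pos hXS.det_pos hX.det_pos).le
  linarith

end LogDet

/-! ### Unit lower triangular matrices and innovations. -/

section Triangular

variable {n : ℕ}

lemma det_one_add_of_isStrictlyLower {B : Matrix (Fin n) (Fin n) ℝ} (hB : IsStrictlyLower B) :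
    (1 + B).det = 1 := by
  rw [det_of_isLowerTriangular]
  · simp [hB _ _ le_rfl]
  · intro i j hij
    have hij' : i < j := hij
    simp [hij'.ne, hB _ _ hij'.le]

/-- A positive definite matrix is diagonalized by congruence with a unit lower triangular matrix. -/
lemma exists_unitLower_mul_mul_transpose_eq_diagonal {K : Matrix (Fin n) (Fin n) ℝ}
    (hK : K.PosDef) :
    ∃ (M : Matrix (Fin n) (Fin n) ℝ) (d : Fin n → ℝ),
      IsStrictlyLower M ∧ (∀ i, 0 < d i) ∧ (1 + M) * K * (1 + M)ᵀ = diagonal d := by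
  have hL : IsUnit (LDL.lowerInv hK) := isUnit_of_invertible _
  set L := LDL.lowerInv hK with hLdef
  have hlow : ∀ i j, i < j → L i j = 0 := fun i j hij => LDL.lowerInv_triangular hK hij
  have hdiag : ∀ i, L i i ≠ 0 := by
    have hdet : L.det ≠ 0 := ((isUnit_iff_isUnit_det _).1 hL).ne_zero
    rw [det_of_isLowerTriangular L fun i j hij => hlow i j hij] at hdet
    exact fun i => Finset.prod_ne_zero_iff.1 hdet i (Finset.mem_univ i)
  have hconj : L * K * Lᵀ = diagonal (LDL.diagEntries hK) := by
    simpa [LDL.diag] using (LDL.diag_eq_lowerInv_conj hK).symm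
  -- Rescaling the rows makes the diagonal of the triangular factor equal to one.
  let E : Matrix (Fin n) (Fin n) ℝ := diagonal fun i => (L i i)⁻¹
  let d : Fin n → ℝ := fun i => (L i i)⁻¹ * LDL.diagEntries hK i * (L i i)⁻¹
  have hd : (E * L) * K * (E * L)ᵀ = diagonal d := by
    calc (E * L) * K * (E * L)ᵀ = E * (L * K * Lᵀ) * Eᵀ := by
          simp only [transpose_mul, Matrix.mul_assoc]
      _ = _ := by simp [hconj, E, d, diagonal_mul_diagonal]
  have hEL : IsUnit (E * L) := by
    rw [isUnit_iff_isUnit_det, det_mul, det_diagonal]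
    exact (Finset.prod_ne_zero_iff.2 fun i _ => inv_ne_zero (hdiag i)).isUnit.mul
      ((isUnit_iff_isUnit_det _).1 hL)
  refine ⟨E * L - 1, d, fun i j hij => ?_, ?_, by simpa using hd⟩
  · rcases hij.eq_or_lt with rfl | hij
    · simp [E, hdiag]
    · simp [E, hlow i j hij, hij.ne]
  · refine posDef_diagonal_iff.1 ?_
    rw [← hd]
    have := hK.mul_mul_conjTranspose_same (B := E * L) (vecMul_injective_of_isUnit hEL)
    simpa using this

lemma det_eq_prod_of_unitLower {K M : Matrix (Fin n) (Fin n) ℝ} {d : Fin n → ℝ}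
    (hM : IsStrictlyLower M) (h : (1 + M) * K * (1 + M)ᵀ = diagonal d) : K.det = ∏ i, d i := by
  have := congrArg det h
  rwa [det_mul, det_mul, det_transpose, det_one_add_of_isStrictlyLower hM, one_mul, mul_one,
    det_diagonal] at this

/-- `(1 + M) K = diagonal d * ((1 + M)⁻¹)ᵀ` is upper triangular. For a vector of covariance `K` this
says that the `i`-th innovation is uncorrelated with the earlier coordinates. -/
lemma unitLower_mul_apply_eq_zero {K M : Matrix (Fin n) (Fin n) ℝ} {d : Fin n → ℝ}
    (hM : IsStrictlyLower M) (h : (1 + M) * K * (1 + M)ᵀ = diagonal d) {i j : Fin n}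
    (hij : j < i) : ((1 + M) * K) i j = 0 := by
  have hu : IsUnit (1 + M).det := by simp [det_one_add_of_isStrictlyLower hM]
  have := invertibleOfIsUnitDet _ hu
  have hlow : (1 + M).BlockTriangular OrderDual.toDual := by
    intro a b hab
    have hab' : a < b := hab
    simp [hab'.ne, hM _ _ hab'.le]
  have hinv := blockTriangular_inv_of_blockTriangular hlow
  have h1 : (1 + M) * K = diagonal d * ((1 + M)⁻¹)ᵀ := by
    rw [← h, Matrix.mul_assoc _ (1 + M)ᵀ, ← transpose_mul, nonsing_inv_mul _ hu, transpose_one,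
      Matrix.mul_one]
  rw [h1, diagonal_mul, transpose_apply, hinv (i := j) (j := i) hij, mul_zero]

end Triangular

/-! ### Mutual information of additive noise models through densities. -/

section Density

variable {Ω α β γ G : Type*} {mΩ : MeasurableSpace Ω} [MeasurableSpace α] [MeasurableSpace β]
  [MeasurableSpace γ] [MeasurableSpace G]

/-- Relative entropy of two probability measures with positive densities. -/
lemma klDiv_withDensity_ofReal {m : Measure α} {p q : α → ℝ}
    (hp : Measurable p) (hq : Measurable q) (hp0 : ∀ x, 0 < p x) (hq0 : ∀ x, 0 < q x)
    {P Q : Measure α} [IsProbabilityMeasure P] [IsProbabilityMeasure Q]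
    (hP : P = m.withDensity fun x => ENNReal.ofReal (q x))
    (hQ : Q = m.withDensity fun x => ENNReal.ofReal (p x))
    (hInt : Integrable (fun x => Real.log (q x) - Real.log (p x)) P) :
    0 ≤ ∫ x, (Real.log (q x) - Real.log (p x)) ∂P ∧
      klDiv P Q = ENNReal.ofReal (∫ x, (Real.log (q x) - Real.log (p x)) ∂P) := by
  have hPQ : P = Q.withDensity fun x => ENNReal.ofReal (q x / p x) := by
    rw [hP, hQ, ← withDensity_mul _ (by fun_prop) (by fun_prop)]
    congr 1
    ext x
    rw [Pi.mul_apply, ← ENNReal.ofReal_mul (hp0 x).le, mul_div_cancel₀ _ (hp0 x).ne']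
  have hac : P ≪ Q := by
    rw [hPQ]
    exact withDensity_absolutelyContinuous _ _
  have hrn : P.rnDeriv Q =ᵐ[Q] fun x => ENNReal.ofReal (q x / p x) := by
    conv_lhs => rw [hPQ]
    exact Measure.rnDeriv_withDensity Q (by fun_prop)
  have hllr : llr P Q =ᵐ[P] fun x => Real.log (q x) - Real.log (p x) := by
    filter_upwards [hac.ae_le hrn] with x hx
    rw [llr, hx, ENNReal.toReal_ofReal (div_pos (hq0 x) (hp0 x)).le,
      Real.log_div (hq0 x).ne' (hp0 x).ne']
  have hInt' : Integrable (llr P Q) P := hInt.congr hllr.symm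
  have h1 := klDiv_of_ac_of_integrable hac hInt'
  have h2 := integral_llr_add_sub_measure_univ_nonneg hac hInt'
  rw [integral_congr_ae hllr] at h1 h2
  simp only [probReal_univ, add_sub_cancel_right] at h1 h2
  exact ⟨h2, h1⟩

/-- Data processing for `e` and for its inverse. -/
lemma klDiv_map_measurableEquiv (e : α ≃ᵐ β) (P Q : Measure α) [IsFiniteMeasure P]
    [IsFiniteMeasure Q] : klDiv (P.map e) (Q.map e) = klDiv P Q := by
  refine le_antisymm (klDiv_map_le _ _ e.measurable) ?_
  have h := klDiv_map_le (P.map e) (Q.map e) e.symm.measurable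
  simpa using h

lemma map_withDensity_comp {f : α → β} (hf : Measurable f) (m : Measure α) {r : β → ℝ≥0∞}
    (hr : Measurable r) :
    (m.withDensity fun x => r (f x)).map f = (m.map f).withDensity r := by
  ext s hs
  rw [Measure.map_apply hf hs, withDensity_apply _ (hf hs), withDensity_apply _ hs,
    setLIntegral_map hs hr hf]

variable [AddCommGroup G] [MeasurableAdd₂ G] [MeasurableSub₂ G]
  {ν : Measure G} [SFinite ν] [ν.IsAddRightInvariant] {μ : Measure Ω} [IsProbabilityMeasure μ]

/-- Joint law of `U` and `F + g U` when the noise `F` is independent of `U` and has a density. -/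
lemma map_prodMk_add_eq_withDensity {U : Ω → β} {F : Ω → G} {g : β → G} {q : G → ℝ}
    (hU : Measurable U) (hF : Measurable F) (hg : Measurable g) (hq : Measurable q)
    (hUF : IndepFun U F μ) (hlaw : μ.map F = ν.withDensity fun t => ENNReal.ofReal (q t)) :
    μ.map (fun ω => (U ω, F ω + g (U ω))) =
      ((μ.map U).prod ν).withDensity fun x => ENNReal.ofReal (q (x.2 - g x.1)) := by
  -- The shear translates each fibre, and `ν` is translation invariant.
  have hpres : MeasurePreserving (fun x : β × G => (x.1, x.2 + g x.1)) ((μ.map U).prod ν)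
      ((μ.map U).prod ν) :=
    (MeasurePreserving.id _).skew_product (g := fun u t => t + g u)
      (by unfold Function.uncurry; fun_prop) (ae_of_all _ fun u => map_add_right_eq_self ν (g u))
  have h1 : μ.map (fun ω => (U ω, F ω + g (U ω))) =
      ((μ.map U).prod (μ.map F)).map fun x => (x.1, x.2 + g x.1) := by
    rw [← hUF.map_prod_eq_prod_map_map hU.aemeasurable hF.aemeasurable,
      Measure.map_map hpres.measurable (hU.prodMk hF)]
    rfl
  rw [h1, hlaw, prod_withDensity_right (by fun_prop)]
  conv_rhs =>
    rw [← hpres.map_eq, ← map_withDensity_comp hpres.measurable _ (by fun_prop)]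
  simp

/-- Relative to `(μ.map U).prod ν`, the joint law has density `q (y - g u)` and the product of the
marginals has density `p y`. Their log-ratio at `(U, Y)` is the integrand. -/
lemma mutualInfo_eq_ofReal {U : Ω → β} {F : Ω → G} {g : β → G} {p q : G → ℝ}
    (hU : Measurable U) (hF : Measurable F) (hg : Measurable g)
    (hp : Measurable p) (hq : Measurable q) (hp0 : ∀ x, 0 < p x) (hq0 : ∀ x, 0 < q x)
    (hUF : IndepFun U F μ) (hlaw : μ.map F = ν.withDensity fun t => ENNReal.ofReal (q t))
    {Y : Ω → G} (hY : ∀ ω, Y ω = F ω + g (U ω))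
    (hlawY : μ.map Y = ν.withDensity fun t => ENNReal.ofReal (p t))
    (hInt : Integrable (fun ω => Real.log (q (F ω)) - Real.log (p (Y ω))) μ) :
    mutualInfo U Y μ = ENNReal.ofReal (∫ ω, (Real.log (q (F ω)) - Real.log (p (Y ω))) ∂μ) /
      ENNReal.ofReal (Real.log 2) := by
  have hYm : Measurable Y := by
    rw [funext hY]
    fun_prop
  have hP := map_prodMk_add_eq_withDensity hU hF hg hq hUF hlaw
  simp_rw [← hY] at hP
  have hQ : (μ.map U).prod (μ.map Y) =
      ((μ.map U).prod ν).withDensity fun x => ENNReal.ofReal (p x.2) := by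
    rw [hlawY, prod_withDensity_right (by fun_prop)]
  have := Measure.isProbabilityMeasure_map (μ := μ) (hU.prodMk hYm).aemeasurable
  have := Measure.isProbabilityMeasure_map (μ := μ) hU.aemeasurable
  have := Measure.isProbabilityMeasure_map (μ := μ) hYm.aemeasurable
  have hcomp : ∀ ω, Real.log (q (Y ω - g (U ω))) - Real.log (p (Y ω)) =
      Real.log (q (F ω)) - Real.log (p (Y ω)) := fun ω => by rw [hY]; simp
  have hmeas : Measurable fun x : β × G => Real.log (q (x.2 - g x.1)) - Real.log (p x.2) := by
    fun_prop
  have hInt' : Integrable (fun x : β × G => Real.log (q (x.2 - g x.1)) - Real.log (p x.2))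
      (μ.map fun ω => (U ω, Y ω)) := by
    rw [integrable_map_measure hmeas.aestronglyMeasurable (hU.prodMk hYm).aemeasurable]
    exact hInt.congr (ae_of_all _ fun ω => (hcomp ω).symm)
  have h := (klDiv_withDensity_ofReal (by fun_prop) (by fun_prop) (fun x => hp0 _)
    (fun x => hq0 _) hP hQ hInt').2
  rw [mutualInfo, h, integral_map (hU.prodMk hYm).aemeasurable hmeas.aestronglyMeasurable]
  simp_rw [hcomp]

/-- Conditional mutual information of `X` and `Y` given `Z` when `Y` is a function of `Z` plus a
noise `E` independent of `Z`, and a function of `(Z, X)` plus a noise `F` independent of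
`(Z, X)`. -/
lemma condMutualInfo_eq_ofReal [StandardBorelSpace α] [Nonempty α] [StandardBorelSpace G]
    {Z : Ω → γ} {X : Ω → α} {E F Y : Ω → G} {f : γ → G} {g : γ × α → G} {p q : G → ℝ}
    (hZ : Measurable Z) (hX : Measurable X) (hE : Measurable E) (hF : Measurable F)
    (hf : Measurable f) (hg : Measurable g)
    (hp : Measurable p) (hq : Measurable q) (hp0 : ∀ x, 0 < p x) (hq0 : ∀ x, 0 < q x)
    (hZE : IndepFun Z E μ) (hlawE : μ.map E = ν.withDensity fun t => ENNReal.ofReal (p t))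
    (hZXF : IndepFun (fun ω => (Z ω, X ω)) F μ)
    (hlawF : μ.map F = ν.withDensity fun t => ENNReal.ofReal (q t))
    (hYE : ∀ ω, Y ω = E ω + f (Z ω)) (hYF : ∀ ω, Y ω = F ω + g (Z ω, X ω))
    (hInt : Integrable (fun ω => Real.log (q (F ω)) - Real.log (p (E ω))) μ) :
    0 ≤ ∫ ω, (Real.log (q (F ω)) - Real.log (p (E ω))) ∂μ ∧
    condMutualInfo X Y Z μ =
      ENNReal.ofReal (∫ ω, (Real.log (q (F ω)) - Real.log (p (E ω))) ∂μ) /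
      ENNReal.ofReal (Real.log 2) := by
  have hYm : Measurable Y := by
    rw [funext hYE]
    fun_prop
  have hU : Measurable fun ω => (Z ω, X ω) := hZ.prodMk hX
  have := Measure.isProbabilityMeasure_map (μ := μ) hZ.aemeasurable
  have := Measure.isProbabilityMeasure_map (μ := μ) hU.aemeasurable
  have := Measure.isProbabilityMeasure_map (μ := μ) hE.aemeasurable
  have := Measure.isProbabilityMeasure_map (μ := μ) (hU.prodMk hYm).aemeasurable
  set ρ := μ.map fun ω => (Z ω, X ω) with hρ
  let P : Measure ((γ × α) × G) := μ.map fun ω => ((Z ω, X ω), Y ω)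
  -- Replacing `E` by a copy independent of `(Z, X)` makes `X` and the new output conditionally
  -- independent given `Z`. So `Q` is the reference measure of `condMutualInfo`, up to
  -- reassociation; this is `hQe` below.
  let Q : Measure ((γ × α) × G) := (ρ.prod (μ.map E)).map fun x => (x.1, x.2 + f x.1.1)
  have hsh : Measurable fun x : (γ × α) × G => (x.1, x.2 + f x.1.1) := by fun_prop
  have : IsProbabilityMeasure P := ‹_›
  have : IsProbabilityMeasure Q := Measure.isProbabilityMeasure_map hsh.aemeasurable
  have hP : P = (ρ.prod ν).withDensity fun x => ENNReal.ofReal (q (x.2 - g x.1)) := by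
    have h := map_prodMk_add_eq_withDensity hU hF hg hq hZXF hlawF
    simp_rw [← hYF] at h
    exact h
  have hQ : Q = (ρ.prod ν).withDensity fun x => ENNReal.ofReal (p (x.2 - f x.1.1)) := by
    have hind : IndepFun (fun x : (γ × α) × G => x.1) (fun x => x.2) (ρ.prod (μ.map E)) :=
      indepFun_prod measurable_id measurable_id
    have h := map_prodMk_add_eq_withDensity (μ := ρ.prod (μ.map E)) (ν := ν)
      (U := fun x => x.1) (F := fun x => x.2) (g := fun u => f u.1) measurable_fst measurable_snd
      (by fun_prop) hp hind (by rw [← hlawE]; exact Measure.map_snd_prod.trans (by simp))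
    rw [show (ρ.prod (μ.map E)).map (fun x => x.1) = ρ from
      Measure.map_fst_prod.trans (by simp)] at h
    exact h
  have hcomp : ∀ ω, Real.log (q (Y ω - g (Z ω, X ω))) - Real.log (p (Y ω - f (Z ω))) =
      Real.log (q (F ω)) - Real.log (p (E ω)) := fun ω => by
    congr 3
    · rw [hYF]; simp
    · rw [hYE]; simp
  have hmeas : Measurable fun x : (γ × α) × G =>
      Real.log (q (x.2 - g x.1)) - Real.log (p (x.2 - f x.1.1)) := by
    fun_prop
  have hInt' : Integrable (fun x : (γ × α) × G =>
      Real.log (q (x.2 - g x.1)) - Real.log (p (x.2 - f x.1.1))) P := by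
    rw [integrable_map_measure hmeas.aestronglyMeasurable (hU.prodMk hYm).aemeasurable]
    exact hInt.congr (ae_of_all _ fun ω => (hcomp ω).symm)
  have h := klDiv_withDensity_ofReal (by fun_prop) (by fun_prop) (fun x => hp0 _)
    (fun x => hq0 _) hP hQ hInt'
  rw [integral_map (hU.prodMk hYm).aemeasurable hmeas.aestronglyMeasurable] at h
  simp_rw [hcomp] at h
  refine ⟨h.1, ?_⟩
  have hPe : μ.map (fun ω => (Z ω, X ω, Y ω)) = P.map MeasurableEquiv.prodAssoc := by
    rw [Measure.map_map (MeasurableEquiv.measurable _) (hU.prodMk hYm)]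
    rfl
  -- `κ z` is the law of `E + f z`, an explicit version of the conditional law of `Y` given `Z`.
  let κ : Kernel γ G := (Kernel.id ×ₖ Kernel.const γ (μ.map E)).map fun x => x.2 + f x.1
  have hκm : Measurable fun x : γ × G => x.2 + f x.1 := by fun_prop
  have : IsMarkovKernel κ := Kernel.IsMarkovKernel.map _ hκm
  have hκ : ∀ (z : γ) (φ : G → ℝ≥0∞), Measurable φ →
      ∫⁻ y, φ y ∂κ z = ∫⁻ t, φ (t + f z) ∂μ.map E := fun z φ hφ => by
    rw [Kernel.lintegral_map _ hκm _ hφ,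
      Kernel.lintegral_id_prod (f := fun x : γ × G => φ (x.2 + f x.1)) (by fun_prop),
      Kernel.const_apply]
  have hcond : condDistrib Y Z μ =ᵐ[μ.map Z] κ := by
    refine condDistrib_ae_eq_of_measure_eq_compProd Z hYm.aemeasurable
      (Measure.ext_of_lintegral _ fun φ hφ => ?_)
    have h1 : μ.map (fun ω => (Z ω, Y ω)) =
        ((μ.map Z).prod (μ.map E)).map fun x => (x.1, x.2 + f x.1) := by
      rw [← hZE.map_prod_eq_prod_map_map hZ.aemeasurable hE.aemeasurable,
        Measure.map_map (by fun_prop) (hZ.prodMk hE)]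
      simp_rw [hYE]
      rfl
    rw [h1, lintegral_map hφ (by fun_prop), lintegral_prod _ (by fun_prop),
      Measure.lintegral_compProd hφ]
    exact lintegral_congr fun z => (hκ z (fun y => φ (z, y)) (by fun_prop)).symm
  have hQe : (μ.map Z) ⊗ₘ (condDistrib X Z μ ×ₖ condDistrib Y Z μ) =
      Q.map MeasurableEquiv.prodAssoc := by
    have hae : condDistrib X Z μ ×ₖ condDistrib Y Z μ =ᵐ[μ.map Z] condDistrib X Z μ ×ₖ κ := by
      filter_upwards [hcond] with z hz
      rw [Kernel.prod_apply, Kernel.prod_apply, hz]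
    rw [Measure.compProd_congr hae]
    refine Measure.ext_of_lintegral _ fun φ hφ => ?_
    have hm : Measurable fun u : γ × α =>
        ∫⁻ t, φ (MeasurableEquiv.prodAssoc (u, t + f u.1)) ∂μ.map E :=
      Measurable.lintegral_prod_right'
        (f := fun x : (γ × α) × G => φ (MeasurableEquiv.prodAssoc (x.1, x.2 + f x.1.1)))
        (by fun_prop)
    rw [Measure.lintegral_compProd hφ, lintegral_map hφ (MeasurableEquiv.measurable _),
      lintegral_map (by fun_prop) hsh, lintegral_prod _ (by fun_prop), hρ,
      ← compProd_map_condDistrib hX.aemeasurable, Measure.lintegral_compProd hm]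
    refine lintegral_congr fun z => ?_
    rw [Kernel.lintegral_prod _ _ _ (by fun_prop)]
    exact lintegral_congr fun x => hκ z (fun y => φ (z, x, y)) (by fun_prop)
  rw [condMutualInfo, hPe, hQe, klDiv_map_measurableEquiv, h.2]

end Density

/-! ### Gaussian densities and their mean logarithms. -/

section GaussianDensity

variable {Ω : Type*} {mΩ : MeasurableSpace Ω} {μ : Measure Ω}

lemma log_gaussianPDFReal_zero {v : ℝ≥0} (hv : v ≠ 0) (x : ℝ) :
    Real.log (gaussianPDFReal 0 v x) = -(1 / 2) * Real.log (2 * Real.pi * v) - x ^ 2 / (2 * v) := by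
  have hv' : (0 : ℝ) < v := by positivity
  rw [gaussianPDFReal, Real.log_mul (by positivity) (Real.exp_pos _).ne', Real.log_exp,
    Real.log_inv, Real.log_sqrt (by positivity)]
  ring

lemma integrable_log_gaussianPDFReal {v : ℝ≥0} (hv : v ≠ 0) :
    Integrable (fun x => Real.log (gaussianPDFReal 0 v x)) (gaussianReal 0 v) := by
  simp_rw [log_gaussianPDFReal_zero hv]
  have h : Integrable (fun x : ℝ => x ^ 2) (gaussianReal 0 v) :=
    (memLp_id_gaussianReal 2).integrable_sq
  exact (integrable_const _).sub (h.div_const _)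

/-- The differential entropy of a centered Gaussian, in nats, up to sign. -/
lemma integral_log_gaussianPDFReal {v : ℝ≥0} (hv : v ≠ 0) :
    ∫ x, Real.log (gaussianPDFReal 0 v x) ∂gaussianReal 0 v =
      -(1 / 2) * Real.log (2 * Real.pi * v) - 1 / 2 := by
  have hv' : (v : ℝ) ≠ 0 := by positivity
  simp_rw [log_gaussianPDFReal_zero hv]
  have h : Integrable (fun x : ℝ => x ^ 2) (gaussianReal 0 v) :=
    (memLp_id_gaussianReal 2).integrable_sq
  have hvar : ∫ x, x ^ 2 ∂gaussianReal 0 v = v := by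
    have := variance_fun_id_gaussianReal (μ := 0) (v := v)
    rwa [variance_of_integral_eq_zero (by fun_prop) (by simp)] at this
  rw [integral_sub (integrable_const _) (h.div_const _), integral_div, hvar]
  simp
  field_simp

lemma integrable_log_gaussianPDFReal_comp {X : Ω → ℝ} {v : ℝ≥0} (hX : Measurable X) (hv : v ≠ 0)
    (h : μ.map X = gaussianReal 0 v) :
    Integrable (fun ω => Real.log (gaussianPDFReal 0 v (X ω))) μ :=
  (h ▸ integrable_log_gaussianPDFReal hv :
    Integrable (fun x => Real.log (gaussianPDFReal 0 v x)) (μ.map X)).comp_measurable hX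

lemma integral_log_gaussianPDFReal_comp {X : Ω → ℝ} {v : ℝ≥0} (hX : Measurable X) (hv : v ≠ 0)
    (h : μ.map X = gaussianReal 0 v) :
    ∫ ω, Real.log (gaussianPDFReal 0 v (X ω)) ∂μ =
      -(1 / 2) * Real.log (2 * Real.pi * v) - 1 / 2 := by
  rw [← integral_log_gaussianPDFReal hv, ← h, integral_map hX.aemeasurable]
  exact (measurable_gaussianPDFReal 0 v).log.aestronglyMeasurable

variable {n : ℕ}

lemma pi_gaussianReal_eq_withDensity {d : Fin n → ℝ≥0} (hd : ∀ i, d i ≠ 0) :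
    Measure.pi (fun i => gaussianReal 0 (d i)) =
      (volume : Measure (Fin n → ℝ)).withDensity
        fun x => ENNReal.ofReal (∏ i, gaussianPDFReal 0 (d i) (x i)) := by
  refine Measure.pi_eq fun s hs => ?_
  have hInt : ∀ i, Integrable (gaussianPDFReal 0 (d i)) (volume.restrict (s i)) := fun i =>
    (integrable_gaussianPDFReal 0 (d i)).restrict
  rw [withDensity_apply _ (MeasurableSet.univ_pi hs), volume_pi, Measure.restrict_pi_pi,
    ← ofReal_integral_eq_lintegral_ofReal (Integrable.fintype_prod hInt)
      (ae_of_all _ fun x => Finset.prod_nonneg fun i _ => gaussianPDFReal_nonneg _ _ _),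
    integral_fintype_prod_eq_prod (fun i => gaussianPDFReal 0 (d i)),
    ENNReal.ofReal_prod_of_nonneg fun i _ => integral_nonneg fun x => gaussianPDFReal_nonneg _ _ _]
  exact Finset.prod_congr rfl fun i _ => (gaussianReal_apply_eq_integral 0 (hd i) (s i)).symm

/-- The density, with respect to Lebesgue measure, of a vector that the unit lower triangular matrix
`1 + M` maps to independent centered Gaussians of variances `d i`. -/
def unitLowerDensity (M : Matrix (Fin n) (Fin n) ℝ) (d : Fin n → ℝ≥0) (x : Fin n → ℝ) : ℝ :=
  ∏ i, gaussianPDFReal 0 (d i) (((1 + M) *ᵥ x) i)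

lemma measurable_unitLowerDensity (M : Matrix (Fin n) (Fin n) ℝ) (d : Fin n → ℝ≥0) :
    Measurable (unitLowerDensity M d) := by
  refine Finset.measurable_prod _ fun i _ => (measurable_gaussianPDFReal 0 (d i)).comp ?_
  simp only [mulVec, dotProduct]
  fun_prop

lemma unitLowerDensity_pos (M : Matrix (Fin n) (Fin n) ℝ) {d : Fin n → ℝ≥0} (hd : ∀ i, d i ≠ 0)
    (x : Fin n → ℝ) : 0 < unitLowerDensity M d x :=
  Finset.prod_pos fun i _ => gaussianPDFReal_pos _ _ _ (hd i)

/-- `1 + M` has determinant one, so the change of variables has no Jacobian factor. -/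
lemma map_eq_withDensity_unitLowerDensity {M : Matrix (Fin n) (Fin n) ℝ} (hM : IsStrictlyLower M)
    {d : Fin n → ℝ≥0} (hd : ∀ i, d i ≠ 0) {T : Ω → Fin n → ℝ} (hT : Measurable T)
    (hind : iIndepFun (fun i ω => ((1 + M) *ᵥ T ω) i) μ)
    (hlaw : ∀ i, μ.map (fun ω => ((1 + M) *ᵥ T ω) i) = gaussianReal 0 (d i)) :
    μ.map T = volume.withDensity fun x => ENNReal.ofReal (unitLowerDensity M d x) := by
  have hdet := det_one_add_of_isStrictlyLower hM
  have hu : IsUnit (1 + M).det := by simp [hdet]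
  have := hind.isProbabilityMeasure
  have hmul : ∀ A : Matrix (Fin n) (Fin n) ℝ, Measurable fun x : Fin n → ℝ => A *ᵥ x := fun A => by
    refine measurable_pi_lambda _ fun i => ?_
    simp only [mulVec, dotProduct]
    fun_prop
  have hmeas : ∀ i, Measurable fun ω => ((1 + M) *ᵥ T ω) i := fun i =>
    (measurable_pi_apply i).comp ((hmul _).comp hT)
  have hvol : (volume : Measure (Fin n → ℝ)).map (fun x => (1 + M)⁻¹ *ᵥ x) = volume := by
    have hdet' : (1 + M)⁻¹.det = 1 := by rw [det_nonsing_inv, hdet, Ring.inverse_one]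
    have := Real.map_matrix_volume_pi_eq_smul_volume_pi (M := (1 + M)⁻¹) (by simp [hdet'])
    rw [hdet'] at this
    simpa using! this
  have h1 : μ.map (fun ω => (1 + M) *ᵥ T ω) =
      volume.withDensity fun x => ENNReal.ofReal (∏ i, gaussianPDFReal 0 (d i) (x i)) := by
    rw [← pi_gaussianReal_eq_withDensity hd]
    have := (iIndepFun_iff_map_fun_eq_pi_map fun i => (hmeas i).aemeasurable).1 hind
    simp_rw [hlaw] at this
    exact this
  have h2 : μ.map T = (μ.map fun ω => (1 + M) *ᵥ T ω).map fun x => (1 + M)⁻¹ *ᵥ x := by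
    rw [Measure.map_map (hmul _) (measurable_pi_lambda _ hmeas)]
    congr 1
    ext1 ω
    simp [nonsing_inv_mul _ hu]
  rw [h2, h1]
  conv_rhs => rw [← hvol, ← map_withDensity_comp (hmul _) _
    (measurable_unitLowerDensity M d).ennreal_ofReal]
  simp [unitLowerDensity, mul_nonsing_inv _ hu]

/-- The log-density is a sum of one-dimensional terms, so only the marginal laws of the innovations
enter its mean. -/
lemma integrable_log_unitLowerDensity {M : Matrix (Fin n) (Fin n) ℝ}
    {d : Fin n → ℝ≥0} (hd : ∀ i, d i ≠ 0) {T : Ω → Fin n → ℝ} (hT : Measurable T)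
    (hlaw : ∀ i, μ.map (fun ω => ((1 + M) *ᵥ T ω) i) = gaussianReal 0 (d i)) :
    Integrable (fun ω => Real.log (unitLowerDensity M d (T ω))) μ ∧
    ∫ ω, Real.log (unitLowerDensity M d (T ω)) ∂μ =
      ∑ i, (-(1 / 2) * Real.log (2 * Real.pi * d i) - 1 / 2) := by
  have hmeas : ∀ i, Measurable fun ω => ((1 + M) *ᵥ T ω) i := fun i => by
    simp only [mulVec, dotProduct]
    fun_prop
  have hlog : ∀ ω, Real.log (unitLowerDensity M d (T ω)) =
      ∑ i, Real.log (gaussianPDFReal 0 (d i) (((1 + M) *ᵥ T ω) i)) := fun ω =>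
    Real.log_prod fun i _ => (gaussianPDFReal_pos _ _ _ (hd i)).ne'
  simp_rw [hlog]
  refine ⟨integrable_finsetSum _ fun i _ =>
    integrable_log_gaussianPDFReal_comp (hmeas i) (hd i) (hlaw i), ?_⟩
  rw [integral_finsetSum _ fun i _ =>
    integrable_log_gaussianPDFReal_comp (hmeas i) (hd i) (hlaw i)]
  exact Finset.sum_congr rfl fun i _ =>
    integral_log_gaussianPDFReal_comp (hmeas i) (hd i) (hlaw i)

end GaussianDensity

/-! ### Linear functionals of the jointly Gaussian sample. -/

section GaussianLaw

variable {n : ℕ}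

lemma covariance_prod_add_add {α β : Type*} [MeasurableSpace α] [MeasurableSpace β]
    {μ : Measure α} {ν : Measure β} [IsProbabilityMeasure μ] [IsProbabilityMeasure ν]
    {f f' : α → ℝ} {g g' : β → ℝ} (hf : MemLp f 2 μ) (hf' : MemLp f' 2 μ) (hg : MemLp g 2 ν)
    (hg' : MemLp g' 2 ν) :
    cov[fun x => f x.1 + g x.2, fun x => f' x.1 + g' x.2; μ.prod ν] =
      cov[f, f'; μ] + cov[g, g'; ν] := by
  have h1 : MemLp (fun x : α × β => f x.1) 2 (μ.prod ν) := hf.comp_fst ν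
  have h1' : MemLp (fun x : α × β => f' x.1) 2 (μ.prod ν) := hf'.comp_fst ν
  have h2 : MemLp (fun x : α × β => g x.2) 2 (μ.prod ν) := hg.comp_snd μ
  have h2' : MemLp (fun x : α × β => g' x.2) 2 (μ.prod ν) := hg'.comp_snd μ
  have hfst : (μ.prod ν).map Prod.fst = μ := Measure.map_fst_prod.trans (by simp)
  have hsnd : (μ.prod ν).map Prod.snd = ν := Measure.map_snd_prod.trans (by simp)
  have e1 : cov[fun x => f x.1, fun x => f' x.1; μ.prod ν] = cov[f, f'; μ] := by
    conv_rhs => rw [← hfst]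
    rw [covariance_map_fun (by rw [hfst]; exact hf.1) (by rw [hfst]; exact hf'.1) (by fun_prop)]
  have e2 : cov[fun x => g x.2, fun x => g' x.2; μ.prod ν] = cov[g, g'; ν] := by
    conv_rhs => rw [← hsnd]
    rw [covariance_map_fun (by rw [hsnd]; exact hg.1) (by rw [hsnd]; exact hg'.1) (by fun_prop)]
  have e3 : cov[fun x => f x.1, fun x => g' x.2; μ.prod ν] = 0 := covariance_fst_snd_prod hf hg'
  have e4 : cov[fun x => g x.2, fun x => f' x.1; μ.prod ν] = 0 := by
    rw [covariance_comm]
    exact covariance_fst_snd_prod hf' hg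
  change cov[(fun x => f x.1) + (fun x => g x.2), (fun x => f' x.1) + (fun x => g' x.2);
    μ.prod ν] = _
  rw [covariance_add_left h1 h2 (h1'.add h2'), covariance_add_right h1 h1' h2',
    covariance_add_right h2 h1' h2', e1, e2, e3, e4]
  ring

lemma dotProduct_ofLp_eq_inner (a : Fin n → ℝ) :
    (fun x : EuclideanSpace ℝ (Fin n) => a ⬝ᵥ x.ofLp) = fun x => inner ℝ (WithLp.toLp 2 a) x := by
  ext x
  simp [PiLp.inner_apply, dotProduct, mul_comm]

lemma memLp_dotProduct_ofLp (K : Matrix (Fin n) (Fin n) ℝ) (a : Fin n → ℝ) :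
    MemLp (fun x : EuclideanSpace ℝ (Fin n) => a ⬝ᵥ x.ofLp) 2 (multivariateGaussian 0 K) := by
  rw [dotProduct_ofLp_eq_inner]
  exact (IsGaussian.memLp_two_id (μ := multivariateGaussian 0 K)).const_inner (WithLp.toLp 2 a)

lemma covariance_dotProduct_ofLp {K : Matrix (Fin n) (Fin n) ℝ} (hK : K.PosSemidef)
    (a b : Fin n → ℝ) :
    cov[fun x : EuclideanSpace ℝ (Fin n) => a ⬝ᵥ x.ofLp, fun x => b ⬝ᵥ x.ofLp;
      multivariateGaussian 0 K] = a ⬝ᵥ K *ᵥ b := by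
  rw [dotProduct_ofLp_eq_inner, dotProduct_ofLp_eq_inner, ← covarianceBilin_apply_eq_cov IsGaussian.memLp_two_id,
    covarianceBilin_multivariateGaussian hK]

/-- Coefficients of a linear functional of the message, the forward noise and the feedback
noise. -/
abbrev Coeff (n : ℕ) : Type := (Fin n → ℝ) × (Fin n → ℝ) × (Fin n → ℝ)

/-- The linear functional with the given coefficients. -/
def functional (c : Coeff n) : Sample n →L[ℝ] ℝ :=
  LinearMap.toContinuousLinearMap
    { toFun := fun ω => c.1 ⬝ᵥ message ω + c.2.1 ⬝ᵥ forwardNoise ω + c.2.2 ⬝ᵥ feedbackNoise ω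
      map_add' := fun ω ω' => by
        simp only [message, forwardNoise, feedbackNoise, Prod.fst_add, Prod.snd_add,
          WithLp.ofLp_add, dotProduct_add]
        ring
      map_smul' := fun r ω => by
        simp only [message, forwardNoise, feedbackNoise, Prod.smul_fst, Prod.smul_snd,
          WithLp.ofLp_smul, dotProduct_smul, RingHom.id_apply, smul_add] }

lemma functional_apply (c : Coeff n) (ω : Sample n) :
    functional c ω = c.1 ⬝ᵥ message ω + c.2.1 ⬝ᵥ forwardNoise ω + c.2.2 ⬝ᵥ feedbackNoise ω := rfl

instance (Ks Kw Kv : Matrix (Fin n) (Fin n) ℝ) : IsGaussian (law Ks Kw Kv) := by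
  unfold law
  infer_instance

variable {Ks Kw Kv : Matrix (Fin n) (Fin n) ℝ}

lemma covariance_functional (hKs : Ks.PosSemidef) (hKw : Kw.PosSemidef) (hKv : Kv.PosSemidef)
    (c c' : Coeff n) :
    cov[fun ω => functional c ω, fun ω => functional c' ω; law Ks Kw Kv] =
      c.1 ⬝ᵥ Ks *ᵥ c'.1 + c.2.1 ⬝ᵥ Kw *ᵥ c'.2.1 + c.2.2 ⬝ᵥ Kv *ᵥ c'.2.2 := by
  have hg : ∀ c : Coeff n, MemLp (fun x : EuclideanSpace ℝ (Fin n) × EuclideanSpace ℝ (Fin n) =>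
      c.2.1 ⬝ᵥ x.1.ofLp + c.2.2 ⬝ᵥ x.2.ofLp) 2
      ((multivariateGaussian 0 Kw).prod (multivariateGaussian 0 Kv)) := fun c =>
    ((memLp_dotProduct_ofLp Kw c.2.1).comp_fst _).add ((memLp_dotProduct_ofLp Kv c.2.2).comp_snd _)
  have h := covariance_prod_add_add (memLp_dotProduct_ofLp Ks c.1)
    (memLp_dotProduct_ofLp Ks c'.1) (hg c) (hg c')
  rw [covariance_prod_add_add (memLp_dotProduct_ofLp Kw c.2.1) (memLp_dotProduct_ofLp Kw c'.2.1)
    (memLp_dotProduct_ofLp Kv c.2.2) (memLp_dotProduct_ofLp Kv c'.2.2),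
    covariance_dotProduct_ofLp hKs, covariance_dotProduct_ofLp hKw,
    covariance_dotProduct_ofLp hKv, ← add_assoc] at h
  rw [← h]
  simp_rw [functional_apply, ← add_assoc]
  rfl

lemma integral_functional (c : Coeff n) : ∫ ω, functional c ω ∂law Ks Kw Kv = 0 := by
  have h0 : ∀ K : Matrix (Fin n) (Fin n) ℝ,
      ∫ x : EuclideanSpace ℝ (Fin n), x ∂multivariateGaussian 0 K = 0 := fun K => by simp
  have hInt : Integrable (fun ω : Sample n => ω) (law Ks Kw Kv) := IsGaussian.integrable_fun_id
  have hzero : ∫ ω, ω ∂law Ks Kw Kv = 0 := by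
    refine Prod.ext ?_ (Prod.ext ?_ ?_)
    · rw [fst_integral hInt, law, integral_fun_fst (fun x => x), h0]
      simp
    · rw [snd_integral hInt, fst_integral hInt.snd, law, integral_fun_snd
          (fun x : EuclideanSpace ℝ (Fin n) × EuclideanSpace ℝ (Fin n) => x.1),
        integral_fun_fst (fun x => x), h0]
      simp
    · rw [snd_integral hInt, snd_integral hInt.snd, law, integral_fun_snd
          (fun x : EuclideanSpace ℝ (Fin n) × EuclideanSpace ℝ (Fin n) => x.2),
        integral_fun_snd (fun x => x), h0]
      simp
  rw [(functional c).integral_comp_comm hInt, hzero, map_zero]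

lemma map_functional (hKs : Ks.PosSemidef) (hKw : Kw.PosSemidef) (hKv : Kv.PosSemidef)
    (c : Coeff n) :
    (law Ks Kw Kv).map (fun ω => functional c ω) = gaussianReal 0
      (c.1 ⬝ᵥ Ks *ᵥ c.1 + c.2.1 ⬝ᵥ Kw *ᵥ c.2.1 + c.2.2 ⬝ᵥ Kv *ᵥ c.2.2).toNNReal := by
  have h := (IsGaussian.hasGaussianLaw_id (μ := law Ks Kw Kv)).map_fun (functional c)
  rw [← covariance_functional hKs hKw hKv, covariance_self (by fun_prop)]
  simpa [integral_functional] using h.map_eq_gaussianReal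

/-- Jointly Gaussian families with vanishing cross-covariances are independent. -/
lemma indepFun_functional (hKs : Ks.PosSemidef) (hKw : Kw.PosSemidef) (hKv : Kv.PosSemidef)
    {ι κ : Type*} [Finite ι] [Finite κ] (c : ι → Coeff n) (c' : κ → Coeff n)
    (h : ∀ i k, (c i).1 ⬝ᵥ Ks *ᵥ (c' k).1 + (c i).2.1 ⬝ᵥ Kw *ᵥ (c' k).2.1 +
      (c i).2.2 ⬝ᵥ Kv *ᵥ (c' k).2.2 = 0) :
    IndepFun (fun ω i => functional (c i) ω) (fun ω k => functional (c' k) ω) (law Ks Kw Kv) := by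
  have := Fintype.ofFinite ι
  have := Fintype.ofFinite κ
  have hg := (IsGaussian.hasGaussianLaw_id (μ := law Ks Kw Kv)).map_fun
    ((ContinuousLinearMap.pi fun i => functional (c i)).prod
      (ContinuousLinearMap.pi fun k => functional (c' k)))
  refine HasGaussianLaw.indepFun_of_covariance_eval (X := fun i ω => functional (c i) ω)
    (Y := fun k ω => functional (c' k) ω) hg fun i k => ?_
  rw [covariance_functional hKs hKw hKv, h]

lemma iIndepFun_functional (hKs : Ks.PosSemidef) (hKw : Kw.PosSemidef) (hKv : Kv.PosSemidef)
    {ι : Type*} [Finite ι] (c : ι → Coeff n)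
    (h : ∀ i k, i ≠ k → (c i).1 ⬝ᵥ Ks *ᵥ (c k).1 + (c i).2.1 ⬝ᵥ Kw *ᵥ (c k).2.1 +
      (c i).2.2 ⬝ᵥ Kv *ᵥ (c k).2.2 = 0) :
    iIndepFun (fun i ω => functional (c i) ω) (law Ks Kw Kv) := by
  have := Fintype.ofFinite ι
  have hg := (IsGaussian.hasGaussianLaw_id (μ := law Ks Kw Kv)).map_fun
    (ContinuousLinearMap.pi fun i => functional (c i))
  refine HasGaussianLaw.iIndepFun_of_covariance_eq_zero (X := fun i ω => functional (c i) ω)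
    hg fun i k hik => ?_
  rw [covariance_functional hKs hKw hKv, h i k hik]

end GaussianLaw

/-! ### Closed forms of the two rates. -/

section Rates

variable {n : ℕ} {B Ks Kw Kv : Matrix (Fin n) (Fin n) ℝ}

/-- The covariance of the noise `w + B (w + v)` at the output. -/
def noiseCov (B Kw Kv : Matrix (Fin n) (Fin n) ℝ) : Matrix (Fin n) (Fin n) ℝ :=
  (1 + B) * Kw * (1 + B)ᵀ + B * Kv * Bᵀ

/-- The covariance of the output given the feedback noise. -/
def condOutputCov (B Ks Kw : Matrix (Fin n) (Fin n) ℝ) : Matrix (Fin n) (Fin n) ℝ :=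
  Ks + (1 + B) * Kw * (1 + B)ᵀ

lemma posDef_unitLower_conj (hKw : Kw.PosDef) (hB : IsStrictlyLower B) :
    ((1 + B) * Kw * (1 + B)ᵀ).PosDef := by
  have hu : IsUnit (1 + B) := by
    rw [isUnit_iff_isUnit_det, det_one_add_of_isStrictlyLower hB]
    exact isUnit_one
  simpa using hKw.mul_mul_conjTranspose_same (B := 1 + B) (vecMul_injective_of_isUnit hu)

lemma posSemidef_mul_mul_transpose (hKv : Kv.PosSemidef) (B : Matrix (Fin n) (Fin n) ℝ) :
    (B * Kv * Bᵀ).PosSemidef := by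
  simpa using hKv.mul_mul_conjTranspose_same B

lemma posDef_noiseCov (hKw : Kw.PosDef) (hKv : Kv.PosSemidef) (hB : IsStrictlyLower B) :
    (noiseCov B Kw Kv).PosDef :=
  (posDef_unitLower_conj hKw hB).add_posSemidef (posSemidef_mul_mul_transpose hKv B)

lemma posDef_condOutputCov (hKs : Ks.PosSemidef) (hKw : Kw.PosDef) (hB : IsStrictlyLower B) :
    (condOutputCov B Ks Kw).PosDef :=
  (posDef_unitLower_conj hKw hB).posSemidef_add hKs

/-- Coefficients of the `i`-th coordinate of `A₁ s + A₂ w + A₃ v`. -/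
def rowCoeff (A₁ A₂ A₃ : Matrix (Fin n) (Fin n) ℝ) (i : Fin n) : Coeff n := (A₁ i, A₂ i, A₃ i)

lemma functional_rowCoeff (A₁ A₂ A₃ : Matrix (Fin n) (Fin n) ℝ) (i : Fin n) (ω : Sample n) :
    functional (rowCoeff A₁ A₂ A₃ i) ω =
      (A₁ *ᵥ message ω + A₂ *ᵥ forwardNoise ω + A₃ *ᵥ feedbackNoise ω) i := rfl

lemma dotProduct_row_mulVec_row (A K C : Matrix (Fin n) (Fin n) ℝ) (i j : Fin n) :
    A i ⬝ᵥ K *ᵥ C j = (A * K * Cᵀ) i j := by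
  rw [dotProduct_mulVec]
  rfl

lemma message_eq (i : Fin n) (ω : Sample n) : message ω i = functional (rowCoeff 1 0 0 i) ω := by
  simp [functional_rowCoeff]

lemma feedbackNoise_eq (i : Fin n) (ω : Sample n) :
    feedbackNoise ω i = functional (rowCoeff 0 0 1 i) ω := by
  simp [functional_rowCoeff]

lemma input_eq (B : Matrix (Fin n) (Fin n) ℝ) (i : Fin n) (ω : Sample n) :
    input B ω i = functional (rowCoeff 1 B B i) ω := by
  simp [functional_rowCoeff, input, mulVec_add, add_assoc]

lemma output_eq (B : Matrix (Fin n) (Fin n) ℝ) (i : Fin n) (ω : Sample n) :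
    output B ω i = functional (rowCoeff 1 (1 + B) B i) ω := by
  simp [functional_rowCoeff, output, input, mulVec_add, add_mulVec]
  ring

lemma measurable_functional (c : Coeff n) : Measurable fun ω => functional c ω :=
  (functional c).continuous.measurable

lemma measurable_message : Measurable (message (n := n)) := by
  refine measurable_pi_lambda _ fun i => ?_
  simp_rw [message_eq]
  exact measurable_functional _

lemma measurable_feedbackNoise : Measurable (feedbackNoise (n := n)) := by
  refine measurable_pi_lambda _ fun i => ?_
  simp_rw [feedbackNoise_eq]
  exact measurable_functional _

lemma measurable_input (B : Matrix (Fin n) (Fin n) ℝ) : Measurable (input B) := by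
  refine measurable_pi_lambda _ fun i => ?_
  simp_rw [input_eq]
  exact measurable_functional _

lemma measurable_output (B : Matrix (Fin n) (Fin n) ℝ) : Measurable (output B) := by
  refine measurable_pi_lambda _ fun i => ?_
  simp_rw [output_eq]
  exact measurable_functional _

lemma inputCov_eq (hKs : Ks.PosSemidef) (hKw : Kw.PosSemidef) (hKv : Kv.PosSemidef)
    (B : Matrix (Fin n) (Fin n) ℝ) :
    inputCov B Ks Kw Kv = Ks + B * (Kw + Kv) * Bᵀ := by
  ext i j
  simp only [inputCov, of_apply, input_eq]
  rw [covariance_functional hKs hKw hKv]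
  simp only [rowCoeff, dotProduct_row_mulVec_row]
  simp [Matrix.mul_add, Matrix.add_mul, add_assoc]

/-- A Gaussian vector with positive definite covariance has a density, whose logarithm has the
expected mean. -/
lemma exists_density (hKs : Ks.PosSemidef) (hKw : Kw.PosSemidef) (hKv : Kv.PosSemidef)
    (A₁ A₂ A₃ : Matrix (Fin n) (Fin n) ℝ) {K : Matrix (Fin n) (Fin n) ℝ}
    (hKeq : K = A₁ * Ks * A₁ᵀ + A₂ * Kw * A₂ᵀ + A₃ * Kv * A₃ᵀ) (hK : K.PosDef) :
    ∃ p : (Fin n → ℝ) → ℝ, Measurable p ∧ (∀ x, 0 < p x) ∧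
      (law Ks Kw Kv).map (fun ω i => functional (rowCoeff A₁ A₂ A₃ i) ω) =
        volume.withDensity (fun x => ENNReal.ofReal (p x)) ∧
      Integrable (fun ω => Real.log (p fun i => functional (rowCoeff A₁ A₂ A₃ i) ω))
        (law Ks Kw Kv) ∧
      ∫ ω, Real.log (p fun i => functional (rowCoeff A₁ A₂ A₃ i) ω) ∂law Ks Kw Kv =
        -(1 / 2) * Real.log K.det - n * ((1 / 2) * Real.log (2 * Real.pi) + 1 / 2) := by
  obtain ⟨M, d, hM, hd, hMd⟩ := exists_unitLower_mul_mul_transpose_eq_diagonal hK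
  have hd' : ∀ i, (d i).toNNReal ≠ 0 := fun i => by simpa using hd i
  have hT : Measurable fun (ω : Sample n) i => functional (rowCoeff A₁ A₂ A₃ i) ω :=
    measurable_pi_lambda _ fun i => measurable_functional _
  -- Whitening by `1 + M` acts on the coefficient matrices, so the innovations are again functionals
  -- of the sample.
  have hrow : ∀ (i : Fin n) (ω : Sample n),
      ((1 + M) *ᵥ fun k => functional (rowCoeff A₁ A₂ A₃ k) ω) i =
        functional (rowCoeff ((1 + M) * A₁) ((1 + M) * A₂) ((1 + M) * A₃) i) ω := fun i ω => by
    simp only [functional_rowCoeff]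
    rw [← mulVec_mulVec, ← mulVec_mulVec, ← mulVec_mulVec, ← mulVec_add, ← mulVec_add]
  have hcov : ∀ i j, (rowCoeff ((1 + M) * A₁) ((1 + M) * A₂) ((1 + M) * A₃) i).1 ⬝ᵥ Ks *ᵥ
        (rowCoeff ((1 + M) * A₁) ((1 + M) * A₂) ((1 + M) * A₃) j).1 +
      (rowCoeff ((1 + M) * A₁) ((1 + M) * A₂) ((1 + M) * A₃) i).2.1 ⬝ᵥ Kw *ᵥ
        (rowCoeff ((1 + M) * A₁) ((1 + M) * A₂) ((1 + M) * A₃) j).2.1 +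
      (rowCoeff ((1 + M) * A₁) ((1 + M) * A₂) ((1 + M) * A₃) i).2.2 ⬝ᵥ Kv *ᵥ
        (rowCoeff ((1 + M) * A₁) ((1 + M) * A₂) ((1 + M) * A₃) j).2.2 =
      diagonal d i j := fun i j => by
    simp only [rowCoeff, dotProduct_row_mulVec_row]
    rw [← hMd, hKeq, ← Matrix.add_apply, ← Matrix.add_apply]
    simp only [transpose_mul, Matrix.mul_add, Matrix.add_mul _ _ (1 + M)ᵀ, Matrix.mul_assoc]
  have hind : iIndepFun (fun i ω => ((1 + M) *ᵥ fun k => functional (rowCoeff A₁ A₂ A₃ k) ω) i)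
      (law Ks Kw Kv) := by
    simp_rw [hrow]
    exact iIndepFun_functional hKs hKw hKv _ fun i k hik => by
      rw [hcov, diagonal_apply_ne _ hik]
  have hlaw : ∀ i, (law Ks Kw Kv).map
      (fun ω => ((1 + M) *ᵥ fun k => functional (rowCoeff A₁ A₂ A₃ k) ω) i) =
      gaussianReal 0 (d i).toNNReal := fun i => by
    simp_rw [hrow]
    rw [map_functional hKs hKw hKv, hcov, diagonal_apply_eq]
  have hlog := integrable_log_unitLowerDensity hd' hT hlaw
  refine ⟨unitLowerDensity M fun i => (d i).toNNReal, measurable_unitLowerDensity _ _,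
    unitLowerDensity_pos _ hd', map_eq_withDensity_unitLowerDensity hM hd' hT hind hlaw,
    hlog.1, hlog.2.trans ?_⟩
  rw [det_eq_prod_of_unitLower hM hMd, Real.log_prod fun i _ => (hd i).ne']
  simp_rw [Real.coe_toNNReal _ (hd _).le]
  have : ∀ i, -(1 / 2) * Real.log (2 * Real.pi * d i) - 1 / 2 = -(1 / 2) * Real.log (d i) -
      ((1 / 2) * Real.log (2 * Real.pi) + 1 / 2) := fun i => by
    rw [Real.log_mul (by positivity) (hd i).ne']
    ring
  simp_rw [this]
  rw [Finset.sum_sub_distrib, ← Finset.mul_sum]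
  simp [mul_add]

lemma ofReal_div_ofReal_log_two_div {x : ℝ} (hn : 0 < n) :
    ENNReal.ofReal x / ENNReal.ofReal (Real.log 2) / n = ENNReal.ofReal (x / Real.log 2 / n) := by
  rw [ENNReal.ofReal_div_of_pos (by positivity), ENNReal.ofReal_div_of_pos (by positivity),
    ENNReal.ofReal_natCast]

/-- The output is the message plus the independent noise `(1 + B) w + B v`; the entropy constants of
output and noise cancel. -/
lemma rate_eq (hn : 0 < n) (hKs : Ks.PosSemidef) (hKw : Kw.PosDef) (hKv : Kv.PosSemidef)
    (hB : IsStrictlyLower B) :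
    rate B Ks Kw Kv = ENNReal.ofReal (1 / (2 * n) *
      Real.logb 2 ((Ks + noiseCov B Kw Kv).det / (noiseCov B Kw Kv).det)) := by
  have hN := posDef_noiseCov hKw hKv hB
  have hY := hN.posSemidef_add hKs
  obtain ⟨q, hq, hq0, hqlaw, hqint, hqval⟩ := exists_density hKs hKw.posSemidef hKv 0 (1 + B) B
    (K := noiseCov B Kw Kv) (by simp [noiseCov]) hN
  obtain ⟨p, hp, hp0, hplaw, hpint, hpval⟩ := exists_density hKs hKw.posSemidef hKv 1 (1 + B) B
    (K := Ks + noiseCov B Kw Kv) (by simp [noiseCov, add_assoc]) hY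
  have hout : (fun (ω : Sample n) i => functional (rowCoeff 1 (1 + B) B i) ω) = output B := by
    ext ω i
    rw [output_eq]
  have hout' : ∀ ω : Sample n, (fun i => functional (rowCoeff 1 (1 + B) B i) ω) = output B ω :=
    fun ω => congrFun hout ω
  simp_rw [hout'] at hpint hpval
  rw [hout] at hplaw
  have hind : IndepFun message (fun (ω : Sample n) i => functional (rowCoeff 0 (1 + B) B i) ω)
      (law Ks Kw Kv) := by
    have h := indepFun_functional hKs hKw.posSemidef hKv (rowCoeff (n := n) 1 0 0)
      (rowCoeff 0 (1 + B) B) fun i k => by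
        simp only [rowCoeff, dotProduct_row_mulVec_row]
        simp
    simp_rw [← message_eq] at h
    exact h
  have h := mutualInfo_eq_ofReal (ν := volume) (g := id) (Y := output B) measurable_message
    (measurable_pi_lambda _ fun i => measurable_functional _) measurable_id hp hq hp0 hq0 hind
    hqlaw (fun ω => by
      ext i
      rw [output_eq, Pi.add_apply, id, message_eq]
      simp only [functional_rowCoeff, Pi.add_apply]
      simp
      ring) hplaw (hqint.sub hpint)
  rw [integral_sub hqint hpint, hqval, hpval] at h
  rw [rate, h, ofReal_div_ofReal_log_two_div hn, Real.logb,
    Real.log_div hY.det_pos.ne' hN.det_pos.ne']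
  congr 1
  have : (n : ℝ) ≠ 0 := by positivity
  field_simp
  ring

lemma sum_mul_eq_sum_subtype_lt {M : Matrix (Fin n) (Fin n) ℝ} (hM : IsStrictlyLower M)
    (i : Fin n) (h : Fin n → ℝ) :
    (M *ᵥ h) i = ∑ j : {j : Fin n // j < i}, M i j * h j := by
  rw [← Finset.sum_subtype (Finset.univ.filter fun j => j < i) (by simp) fun j => M i j * h j,
    Finset.sum_filter_of_ne]
  · rfl
  · intro j _ hj
    by_contra hij
    exact hj (by rw [hM _ _ (not_lt.1 hij), zero_mul])

/-- Given `v` and the past outputs, `y_i` is uncertain by the `i`-th innovation of `s + (1 + B) w`,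
of variance `d i`. Given also the inputs up to time `i`, it is uncertain only by the `i`-th
innovation of `w`, of variance `e i`. -/
lemma condMutualInfo_input_output (hKs : Ks.PosSemidef) (hKw : Kw.PosDef) (hKv : Kv.PosSemidef)
    (hB : IsStrictlyLower B) {M N : Matrix (Fin n) (Fin n) ℝ} {d e : Fin n → ℝ}
    (hM : IsStrictlyLower M) (hd : ∀ i, 0 < d i)
    (hMd : (1 + M) * condOutputCov B Ks Kw * (1 + M)ᵀ = diagonal d)
    (hN : IsStrictlyLower N) (he : ∀ i, 0 < e i)
    (hNe : (1 + N) * Kw * (1 + N)ᵀ = diagonal e) (i : Fin n) :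
    0 ≤ (Real.log (d i) - Real.log (e i)) / 2 ∧
    condMutualInfo (fun ω (j : {j : Fin n // j ≤ i}) => input B ω j) (fun ω => output B ω i)
      (fun ω => ((fun j : {j : Fin n // j < i} => output B ω j), feedbackNoise ω))
      (law Ks Kw Kv) =
      ENNReal.ofReal ((Real.log (d i) - Real.log (e i)) / 2) / ENNReal.ofReal (Real.log 2) := by
  have hKw' := hKw.posSemidef
  have hd' : (d i).toNNReal ≠ 0 := by simpa using hd i
  have he' : (e i).toNNReal ≠ 0 := by simpa using he i
  let cE : Coeff n := rowCoeff (1 + M) ((1 + M) * (1 + B)) 0 i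
  let cF : Coeff n := rowCoeff 0 (1 + N) 0 i
  have hE : (law Ks Kw Kv).map (fun ω => functional cE ω) = gaussianReal 0 (d i).toNNReal := by
    rw [map_functional hKs hKw' hKv]
    congr 2
    simp only [cE, rowCoeff, dotProduct_row_mulVec_row]
    rw [← diagonal_apply_eq d i, ← hMd, ← Matrix.add_apply, ← Matrix.add_apply]
    refine congrFun (congrFun ?_ i) i
    simp only [condOutputCov, transpose_mul]
    noncomm_ring
  have hF : (law Ks Kw Kv).map (fun ω => functional cF ω) = gaussianReal 0 (e i).toNNReal := by
    rw [map_functional hKs hKw' hKv]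
    congr 2
    simp only [cF, rowCoeff, dotProduct_row_mulVec_row]
    rw [← diagonal_apply_eq e i, ← hNe]
    simp
  have hZE : IndepFun
      (fun ω => ((fun j : {j : Fin n // j < i} => output B ω j), feedbackNoise ω))
      (fun ω => functional cE ω) (law Ks Kw Kv) := by
    have h := indepFun_functional hKs hKw' hKv (fun _ : Unit => cE)
      (Sum.elim (fun j : {j : Fin n // j < i} => rowCoeff 1 (1 + B) B j)
        (rowCoeff (n := n) 0 0 1)) (by
        rintro - (⟨j, hj⟩ | j)
        · have h0 := unitLower_mul_apply_eq_zero hM hMd hj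
          simp only [cE, Sum.elim_inl, rowCoeff, dotProduct_row_mulVec_row]
          rw [← h0, ← Matrix.add_apply, ← Matrix.add_apply]
          refine congrFun (congrFun ?_ i) j
          simp only [condOutputCov, transpose_one]
          noncomm_ring
        · simp only [cE, Sum.elim_inr, rowCoeff, dotProduct_row_mulVec_row]
          simp)
    have hφ : Measurable fun x : Unit → ℝ => x () := measurable_pi_apply ()
    have hψ : Measurable fun x : {j : Fin n // j < i} ⊕ Fin n → ℝ =>
      ((fun j => x (Sum.inl j)), (fun j => x (Sum.inr j))) := by fun_prop
    have h' := (h.comp hφ hψ).symm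
    simpa [Function.comp_def, ← output_eq, ← feedbackNoise_eq] using h'
  -- Feedback is strictly causal: for `k ≤ i`, row `k` of `B` involves only `w_j` with `j < i`,
  -- which the innovation of `w_i` does not see.
  have hNB : ∀ k, k ≤ i → ((1 + N) * Kw * Bᵀ) i k = 0 := fun k hk => by
    rw [Matrix.mul_apply]
    refine Finset.sum_eq_zero fun j _ => ?_
    rcases lt_or_ge j i with hj | hj
    · rw [unitLower_mul_apply_eq_zero hN hNe hj, zero_mul]
    · rw [transpose_apply, hB _ _ (hk.trans hj), mul_zero]
  have hZXF : IndepFun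
      (fun ω => (((fun j : {j : Fin n // j < i} => output B ω j), feedbackNoise ω),
        fun j : {j : Fin n // j ≤ i} => input B ω j))
      (fun ω => functional cF ω) (law Ks Kw Kv) := by
    have h := indepFun_functional hKs hKw' hKv (fun _ : Unit => cF)
      (Sum.elim (Sum.elim (fun j : {j : Fin n // j < i} => rowCoeff 1 (1 + B) B j)
        (rowCoeff (n := n) 0 0 1)) (fun j : {j : Fin n // j ≤ i} => rowCoeff 1 B B j)) (by
        rintro - ((⟨j, hj⟩ | j) | ⟨j, hj⟩)
        · have h0 := unitLower_mul_apply_eq_zero hN hNe hj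
          simp only [cF, Sum.elim_inl, rowCoeff, dotProduct_row_mulVec_row]
          rw [transpose_add, Matrix.mul_add _ (1 : Matrix (Fin n) (Fin n) ℝ)ᵀ, Matrix.add_apply,
            hNB j hj.le]
          simp [h0]
        · simp only [cF, Sum.elim_inl, Sum.elim_inr, rowCoeff, dotProduct_row_mulVec_row]
          simp
        · simp only [cF, Sum.elim_inr, rowCoeff, dotProduct_row_mulVec_row]
          rw [hNB j hj]
          simp)
    have hφ : Measurable fun x : Unit → ℝ => x () := measurable_pi_apply ()
    have hψ : Measurable fun x : ({j : Fin n // j < i} ⊕ Fin n) ⊕ {j : Fin n // j ≤ i} → ℝ =>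
      (((fun j => x (Sum.inl (Sum.inl j))), (fun j => x (Sum.inl (Sum.inr j)))),
        (fun j => x (Sum.inr j))) := by fun_prop
    have h' := (h.comp hφ hψ).symm
    simpa [Function.comp_def, ← output_eq, ← feedbackNoise_eq, ← input_eq] using h'
  have hlogE := integrable_log_gaussianPDFReal_comp (measurable_functional cE) hd' hE
  have hlogF := integrable_log_gaussianPDFReal_comp (measurable_functional cF) he' hF
  have hvalE := integral_log_gaussianPDFReal_comp (measurable_functional cE) hd' hE
  have hvalF := integral_log_gaussianPDFReal_comp (measurable_functional cF) he' hF
  rw [gaussianReal_of_var_ne_zero _ hd'] at hE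
  rw [gaussianReal_of_var_ne_zero _ he'] at hF
  have h := condMutualInfo_eq_ofReal (ν := volume) (μ := law Ks Kw Kv)
    (Z := fun ω => ((fun j : {j : Fin n // j < i} => output B ω j), feedbackNoise ω))
    (X := fun ω (j : {j : Fin n // j ≤ i}) => input B ω j) (Y := fun ω => output B ω i)
    -- `f` and `g` are the predictors of `y_i`. They solve the innovation equations for `y_i`, using
    -- `y - B v = s + (1 + B) w` for `f` and `w = y - x` for `g`.
    (f := fun z => (B *ᵥ z.2) i -
      ∑ j : {j : Fin n // j < i}, M i j * (z.1 j - (B *ᵥ z.2) j))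
    (g := fun z => z.2 ⟨i, le_rfl⟩ -
      ∑ j : {j : Fin n // j < i}, N i j * (z.1.1 j - z.2 ⟨j, j.2.le⟩))
    (by have := measurable_output B; have := measurable_feedbackNoise (n := n); fun_prop)
    (by have := measurable_input B; fun_prop)
    (measurable_functional cE) (measurable_functional cF)
    (by simp only [mulVec, dotProduct]; fun_prop) (by fun_prop)
    (measurable_gaussianPDFReal 0 _) (measurable_gaussianPDFReal 0 _)
    (fun x => gaussianPDFReal_pos _ _ x hd') (fun x => gaussianPDFReal_pos _ _ x he')
    hZE hE hZXF hF
    (fun ω => by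
      rw [← sum_mul_eq_sum_subtype_lt hM i fun j => output B ω j - (B *ᵥ feedbackNoise ω) j]
      have hY : (fun j => output B ω j - (B *ᵥ feedbackNoise ω) j) =
          message ω + (1 + B) *ᵥ forwardNoise ω := by
        ext j
        simp [output_eq, functional_rowCoeff]
      rw [hY, output_eq]
      simp only [cE, functional_rowCoeff, ← mulVec_mulVec, Pi.add_apply]
      simp only [add_mulVec 1 M, Pi.add_apply, mulVec_add M]
      simp
      ring)
    (fun ω => by
      rw [← sum_mul_eq_sum_subtype_lt hN i fun j => output B ω j - input B ω j]
      have hW : (fun j => output B ω j - input B ω j) = forwardNoise ω := by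
        ext j
        simp [output]
      rw [hW]
      simp [cF, functional_rowCoeff, output, add_mulVec]
      ring) (hlogF.sub hlogE)
  rw [integral_sub hlogF hlogE, hvalE, hvalF, Real.coe_toNNReal _ (hd i).le,
    Real.coe_toNNReal _ (he i).le, Real.log_mul (by positivity) (hd i).ne',
    Real.log_mul (by positivity) (he i).ne'] at h
  have hval : -(1 / 2) * (Real.log (2 * Real.pi) + Real.log (e i)) - 1 / 2 -
      (-(1 / 2) * (Real.log (2 * Real.pi) + Real.log (d i)) - 1 / 2) =
      (Real.log (d i) - Real.log (e i)) / 2 := by ring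
  rwa [hval] at h

lemma directedRate_eq (hn : 0 < n) (hKs : Ks.PosSemidef) (hKw : Kw.PosDef) (hKv : Kv.PosSemidef)
    (hB : IsStrictlyLower B) :
    directedRate B Ks Kw Kv = ENNReal.ofReal (1 / (2 * n) *
      (Real.logb 2 (condOutputCov B Ks Kw).det - Real.logb 2 Kw.det)) := by
  obtain ⟨M, d, hM, hd, hMd⟩ := exists_unitLower_mul_mul_transpose_eq_diagonal
    (posDef_condOutputCov hKs hKw hB)
  obtain ⟨N, e, hN, he, hNe⟩ := exists_unitLower_mul_mul_transpose_eq_diagonal hKw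
  have h := condMutualInfo_input_output hKs hKw hKv hB hM hd hMd hN he hNe
  have hsum : condDirectedInfo (input B) (output B) feedbackNoise (law Ks Kw Kv) =
      ENNReal.ofReal (∑ i, (Real.log (d i) - Real.log (e i)) / 2) /
        ENNReal.ofReal (Real.log 2) := by
    -- `ENNReal.ofReal` commutes with the sum only because each term is nonnegative, hence the first
    -- half of `h`.
    rw [condDirectedInfo, Finset.sum_congr rfl fun i _ => (h i).2,
      ENNReal.ofReal_sum_of_nonneg fun i _ => (h i).1]
    simp only [div_eq_mul_inv, Finset.sum_mul]
  rw [directedRate, hsum, ofReal_div_ofReal_log_two_div hn, det_eq_prod_of_unitLower hM hMd,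
    det_eq_prod_of_unitLower hN hNe, Real.logb, Real.logb, Real.log_prod fun i _ => (hd i).ne',
    Real.log_prod fun i _ => (he i).ne', ← Finset.sum_div, Finset.sum_sub_distrib]
  congr 1
  have : (n : ℝ) ≠ 0 := by positivity
  field_simp

end Rates

/-! ### The max-det program in terms of schemes. -/

section Program

variable {n : ℕ} {Kw Kv : Matrix (Fin n) (Fin n) ℝ} {P : ℝ}

lemma posDef_fromBlocks_diagonal {X Y : Matrix (Fin n) (Fin n) ℝ} (hX : X.PosDef)
    (hY : Y.PosDef) : (fromBlocks X 0 0 Y).PosDef := by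
  have := hX.isUnit.invertible
  have h : (fromBlocks X 0 0 Y).PosSemidef := by
    simpa using (PosDef.fromBlocks₁₁ 0 Y hX).2 (by simpa using hY.posSemidef)
  rw [h.posDef_iff_det_ne_zero, det_fromBlocks_zero₂₁]
  exact (mul_pos hX.det_pos hY.det_pos).ne'

/-- Schur complement with respect to the lower right block `diag(Kw⁻¹, Kv⁻¹)`. -/
lemma posSemidef_constraintBlock_iff (hKw : Kw.PosDef) (hKv : Kv.PosDef)
    (H B : Matrix (Fin n) (Fin n) ℝ) :
    (constraintBlock Kw Kv H B).PosSemidef ↔ (H - noiseCov B Kw Kv).PosSemidef := by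
  have hD := posDef_fromBlocks_diagonal hKw.inv hKv.inv
  have := hD.isUnit.invertible
  have hinv : (fromBlocks Kw⁻¹ 0 0 Kv⁻¹)⁻¹ = fromBlocks Kw 0 0 Kv := by
    refine inv_eq_right_inv ?_
    rw [fromBlocks_multiply]
    simp [nonsing_inv_mul _ ((isUnit_iff_isUnit_det _).1 hKw.isUnit),
      nonsing_inv_mul _ ((isUnit_iff_isUnit_det _).1 hKv.isUnit)]
  have hcT : (fromCols (1 + B) B)ᴴ = fromRows (1 + Bᵀ) Bᵀ := by
    rw [conjTranspose_eq_transpose_of_trivial, transpose_fromCols, transpose_add, transpose_one]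
  have h := PosDef.fromBlocks₂₂ H (fromCols (1 + B) B) hD
  rw [hinv, fromCols_mul_fromBlocks, hcT, fromCols_mul_fromRows] at h
  rw [constraintBlock, h]
  simp [noiseCov]

/-- Under `Ks = H - noiseCov B Kw Kv` the feasible pairs are exactly the schemes that meet the power
constraint. -/
lemma mem_feasible_iff (hKw : Kw.PosDef) (hKv : Kv.PosDef) (H B : Matrix (Fin n) (Fin n) ℝ) :
    (H, B) ∈ feasible Kw Kv P ↔ IsStrictlyLower B ∧ (H - noiseCov B Kw Kv).PosSemidef ∧
      ((H - noiseCov B Kw Kv) + B * (Kw + Kv) * Bᵀ).trace ≤ n * P := by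
  have h : (H - noiseCov B Kw Kv) + B * (Kw + Kv) * Bᵀ = H - Kw * Bᵀ - B * Kw - Kw := by
    rw [noiseCov, transpose_add, transpose_one]
    noncomm_ring
  rw [h, ← posSemidef_constraintBlock_iff hKw hKv]
  simp only [feasible, Set.mem_ofPred_eq]
  tauto

lemma sub_eq_condOutputCov (H B : Matrix (Fin n) (Fin n) ℝ) :
    H - B * Kv * Bᵀ = condOutputCov B (H - noiseCov B Kw Kv) Kw := by
  rw [condOutputCov, noiseCov]
  abel

lemma det_objectiveBlock (hKv : Kv.PosDef) (H B : Matrix (Fin n) (Fin n) ℝ) :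
    (objectiveBlock Kv H B).det =
      Kv⁻¹.det * (condOutputCov B (H - noiseCov B Kw Kv) Kw).det := by
  have := hKv.inv.isUnit.invertible
  rw [objectiveBlock, det_fromBlocks₁₁, invOf_eq_nonsing_inv,
    nonsing_inv_nonsing_inv _ ((isUnit_iff_isUnit_det _).1 hKv.isUnit),
    sub_eq_condOutputCov (Kw := Kw)]

lemma posDef_objectiveBlock (hKw : Kw.PosDef) (hKv : Kv.PosDef) {H B : Matrix (Fin n) (Fin n) ℝ}
    (hB : IsStrictlyLower B) (h : (H - noiseCov B Kw Kv).PosSemidef) :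
    (objectiveBlock Kv H B).PosDef := by
  have := hKv.inv.isUnit.invertible
  have hC := posDef_condOutputCov h hKw hB
  have hpsd : (objectiveBlock Kv H B).PosSemidef := by
    have h := (PosDef.fromBlocks₁₁ Bᵀ H hKv.inv).2 (by
      rw [nonsing_inv_nonsing_inv _ ((isUnit_iff_isUnit_det _).1 hKv.isUnit)]
      simpa [sub_eq_condOutputCov (Kw := Kw)] using hC.posSemidef)
    simpa [objectiveBlock] using h
  rw [hpsd.posDef_iff_det_ne_zero, det_objectiveBlock (Kw := Kw) hKv]
  exact (mul_pos hKv.inv.det_pos hC.det_pos).ne'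

lemma objective_eq (hKw : Kw.PosDef) (hKv : Kv.PosDef) {H B : Matrix (Fin n) (Fin n) ℝ}
    (hB : IsStrictlyLower B) (h : (H - noiseCov B Kw Kv).PosSemidef) :
    objective Kw Kv (H, B) = 1 / (2 * n) *
      (Real.logb 2 (condOutputCov B (H - noiseCov B Kw Kv) Kw).det - Real.logb 2 Kw.det) := by
  rw [objective, det_objectiveBlock (Kw := Kw) hKv, det_mul,
    Real.logb_mul hKv.inv.det_pos.ne' (posDef_condOutputCov h hKw hB).det_pos.ne',
    Real.logb_mul hKv.inv.det_pos.ne' hKw.det_pos.ne']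
  ring

/-- The block is affine, not linear, in `(H, B)`; `a + b = 1` keeps its constant entries. -/
lemma constraintBlock_combo (p q : Matrix (Fin n) (Fin n) ℝ × Matrix (Fin n) (Fin n) ℝ) {a b : ℝ}
    (hab : a + b = 1) :
    constraintBlock Kw Kv (a • p + b • q).1 (a • p + b • q).2 =
      a • constraintBlock Kw Kv p.1 p.2 + b • constraintBlock Kw Kv q.1 q.2 := by
  obtain rfl : b = 1 - a := by linarith
  ext (i | i | i) (j | j | j) <;> simp [constraintBlock] <;> ring

lemma objectiveBlock_combo (p q : Matrix (Fin n) (Fin n) ℝ × Matrix (Fin n) (Fin n) ℝ) {a b : ℝ}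
    (hab : a + b = 1) :
    objectiveBlock Kv (a • p + b • q).1 (a • p + b • q).2 =
      a • objectiveBlock Kv p.1 p.2 + b • objectiveBlock Kv q.1 q.2 := by
  obtain rfl : b = 1 - a := by linarith
  ext (i | i) (j | j) <;> simp [objectiveBlock]
  ring

lemma convex_feasible : Convex ℝ (feasible Kw Kv P) := by
  intro p hp q hq a b ha hb hab
  refine ⟨?_, ?_, ?_⟩
  · have h : (a • p + b • q).1 - Kw * (a • p + b • q).2ᵀ - (a • p + b • q).2 * Kw - Kw =
        a • (p.1 - Kw * p.2ᵀ - p.2 * Kw - Kw) + b • (q.1 - Kw * q.2ᵀ - q.2 * Kw - Kw) := by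
      obtain rfl : b = 1 - a := by linarith
      simp only [Prod.fst_add, Prod.snd_add, Prod.smul_fst, Prod.smul_snd, transpose_add,
        transpose_smul, Matrix.mul_add, Matrix.add_mul, Matrix.mul_smul, Matrix.smul_mul]
      module
    rw [h, trace_add, trace_smul, trace_smul, smul_eq_mul, smul_eq_mul]
    have h1 := mul_le_mul_of_nonneg_left hp.1 ha
    have h2 := mul_le_mul_of_nonneg_left hq.1 hb
    have h3 : a * (n * P) + b * (n * P) = n * P := by rw [← add_mul, hab, one_mul]
    linarith
  · rw [constraintBlock_combo p q hab]
    exact (PosSemidef.smul hp.2.1 ha).add (PosSemidef.smul hq.2.1 hb)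
  · intro i j hij
    simp [hp.2.2 i j hij, hq.2.2 i j hij]

lemma concaveOn_objective (hKw : Kw.PosDef) (hKv : Kv.PosDef) :
    ConcaveOn ℝ (feasible Kw Kv P) (objective Kw Kv) := by
  refine ⟨convex_feasible, fun p hp q hq a b ha hb hab => ?_⟩
  have hpd : ∀ p ∈ feasible Kw Kv P, (objectiveBlock Kv p.1 p.2).PosDef := fun p hp =>
    have h := (mem_feasible_iff hKw hKv p.1 p.2).1 hp
    posDef_objectiveBlock hKw hKv h.1 h.2.1
  have h := concaveOn_log_det.2 (hpd p hp) (hpd q hq) ha hb hab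
  simp only [smul_eq_mul] at h ⊢
  simp only [objective, objectiveBlock_combo p q hab, Real.logb]
  set k := Real.log (Kv⁻¹ * Kw).det / Real.log 2
  have hc : 0 ≤ 1 / (2 * (n : ℝ)) / Real.log 2 := by positivity
  have h' := mul_le_mul_of_nonneg_left h hc
  obtain rfl : b = 1 - a := by linarith
  refine le_trans (le_of_eq ?_) ((sub_le_sub_right h' (1 / (2 * n) * k)).trans (le_of_eq ?_)) <;>
    ring

end Program

/-! ### Compactness of the schemes, continuity and comparison of the rates. -/

section Maxima

variable {n : ℕ} {Kw Kv : Matrix (Fin n) (Fin n) ℝ} {P : ℝ}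

/-- The linear schemes `(B, Ks)` that meet the power constraint. -/
def schemes (Kw Kv : Matrix (Fin n) (Fin n) ℝ) (P : ℝ) :
    Set (Matrix (Fin n) (Fin n) ℝ × Matrix (Fin n) (Fin n) ℝ) :=
  {x | IsStrictlyLower x.1 ∧ x.2.PosSemidef ∧ (x.2 + x.1 * (Kw + Kv) * x.1ᵀ).trace ≤ n * P}

lemma isClosed_setOf_posSemidef : IsClosed {A : Matrix (Fin n) (Fin n) ℝ | A.PosSemidef} := by
  simp only [posSemidef_iff_dotProduct_mulVec, Set.ofPred_and, Set.ofPred_forall]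
  refine IsClosed.inter ?_ (isClosed_iInter fun x => ?_)
  · exact isClosed_eq (by fun_prop) (by fun_prop)
  · exact isClosed_le (by fun_prop) (by fun_prop)

lemma isClosed_schemes : IsClosed (schemes Kw Kv P) := by
  have hlow : IsClosed {x : Matrix (Fin n) (Fin n) ℝ × Matrix (Fin n) (Fin n) ℝ |
      IsStrictlyLower x.1} := by
    simp only [IsStrictlyLower, Set.ofPred_forall]
    exact isClosed_iInter fun i => isClosed_iInter fun j => isClosed_iInter fun _ =>
      isClosed_eq (continuous_fst.matrix_elem i j) continuous_const
  have htr : IsClosed {x : Matrix (Fin n) (Fin n) ℝ × Matrix (Fin n) (Fin n) ℝ |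
      (x.2 + x.1 * (Kw + Kv) * x.1ᵀ).trace ≤ n * P} :=
    isClosed_le (Continuous.matrix_trace (by fun_prop)) continuous_const
  exact hlow.inter ((isClosed_setOf_posSemidef.preimage continuous_snd).inter htr)

/-- The trace is the sum of the squared entries; the bound `c + 1` follows from `t² ≤ c` without a
square root. -/
lemma abs_apply_le_of_trace_mul_transpose_le {A : Matrix (Fin n) (Fin n) ℝ} {c : ℝ}
    (h : (A * Aᵀ).trace ≤ c) (i j : Fin n) : |A i j| ≤ c + 1 := by
  have h1 : A i j ^ 2 ≤ (A * Aᵀ).trace := by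
    simp only [trace, diag, Matrix.mul_apply, transpose_apply, ← sq]
    exact (Finset.single_le_sum (f := fun j => A i j ^ 2) (fun j _ => sq_nonneg _)
      (Finset.mem_univ j)).trans (Finset.single_le_sum (f := fun i => ∑ j, A i j ^ 2)
        (fun i _ => Finset.sum_nonneg fun j _ => sq_nonneg _) (Finset.mem_univ i))
  rw [abs_le]
  constructor <;> nlinarith

lemma isCompact_setOf_abs_apply_le (c : ℝ) :
    IsCompact {A : Matrix (Fin n) (Fin n) ℝ | ∀ i j, |A i j| ≤ c} := by
  have h : {A : Matrix (Fin n) (Fin n) ℝ | ∀ i j, |A i j| ≤ c} =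
      Set.univ.pi fun _ => Set.univ.pi fun _ => Set.Icc (-c) c := by
    ext A
    simp only [Set.mem_ofPred_eq, abs_le]
    exact ⟨fun h i _ j _ => h i j, fun h i j => h i trivial j trivial⟩
  rw [h]
  exact isCompact_univ_pi fun _ => isCompact_univ_pi fun _ => isCompact_Icc

/-- With `Kw + Kv = G Gᵀ` and `Ks = C Cᵀ`, the power constraint bounds the entries of `B G` and `C`.
The schemes therefore form a closed subset of the continuous image of a compact box. -/
lemma isCompact_schemes (hKw : Kw.PosDef) (hKv : Kv.PosDef) : IsCompact (schemes Kw Kv P) := by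
  obtain ⟨G, hG, hGK⟩ := exists_isUnit_mul_transpose (hKw.add hKv)
  have hbox := isCompact_setOf_abs_apply_le (n := n) (n * P + 1)
  have himg := (hbox.prod hbox).image (f := fun x => (x.1 * G⁻¹, x.2 * x.2ᵀ)) (by fun_prop)
  refine himg.of_isClosed_subset isClosed_schemes ?_
  rintro ⟨B, Ks⟩ ⟨-, hKs, htr⟩
  obtain ⟨C, rfl⟩ := exists_mul_transpose hKs
  have hB : B * (Kw + Kv) * Bᵀ = (B * G) * (B * G)ᵀ := by
    rw [hGK, transpose_mul]
    simp only [Matrix.mul_assoc]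
  simp only [hB, trace_add] at htr
  have h1 : 0 ≤ (C * Cᵀ).trace := by simpa using (posSemidef_self_mul_conjTranspose C).trace_nonneg
  have h2 : 0 ≤ ((B * G) * (B * G)ᵀ).trace := by
    simpa using (posSemidef_self_mul_conjTranspose (B * G)).trace_nonneg
  refine ⟨(B * G, C), ⟨abs_apply_le_of_trace_mul_transpose_le (by linarith),
    abs_apply_le_of_trace_mul_transpose_le (by linarith)⟩, ?_⟩
  simp [Matrix.mul_assoc, mul_nonsing_inv _ ((isUnit_iff_isUnit_det _).1 hG)]

/-- The rate `(1/n) I(S; Y)` of the scheme `(B, Ks)` as a real number. -/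
def rateReal (Kw Kv : Matrix (Fin n) (Fin n) ℝ)
    (x : Matrix (Fin n) (Fin n) ℝ × Matrix (Fin n) (Fin n) ℝ) : ℝ :=
  1 / (2 * n) * Real.logb 2 ((x.2 + noiseCov x.1 Kw Kv).det / (noiseCov x.1 Kw Kv).det)

/-- The rate `(1/n) I(X → Y | V)` of the scheme `(B, Ks)` as a real number. -/
def directedRateReal (Kw : Matrix (Fin n) (Fin n) ℝ)
    (x : Matrix (Fin n) (Fin n) ℝ × Matrix (Fin n) (Fin n) ℝ) : ℝ :=
  1 / (2 * n) * (Real.logb 2 (condOutputCov x.1 x.2 Kw).det - Real.logb 2 Kw.det)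

lemma continuousOn_rateReal (hKw : Kw.PosDef) (hKv : Kv.PosDef) :
    ContinuousOn (rateReal Kw Kv) (schemes Kw Kv P) := by
  have hN : ∀ x ∈ schemes Kw Kv P, 0 < (noiseCov x.1 Kw Kv).det := fun x hx =>
    (posDef_noiseCov hKw hKv.posSemidef hx.1).det_pos
  have hY : ∀ x ∈ schemes Kw Kv P, 0 < (x.2 + noiseCov x.1 Kw Kv).det := fun x hx =>
    ((posDef_noiseCov hKw hKv.posSemidef hx.1).posSemidef_add hx.2.1).det_pos
  unfold rateReal Real.logb
  refine ((ContinuousOn.log (ContinuousOn.div ?_ ?_ fun x hx => (hN x hx).ne')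
    fun x hx => (div_pos (hY x hx) (hN x hx)).ne').div_const _).const_mul _
  all_goals
    unfold noiseCov
    exact Continuous.continuousOn (Continuous.matrix_det (by fun_prop))

lemma continuousOn_directedRateReal (hKw : Kw.PosDef) :
    ContinuousOn (directedRateReal Kw) (schemes Kw Kv P) := by
  unfold directedRateReal Real.logb
  refine ContinuousOn.const_mul (ContinuousOn.sub (ContinuousOn.div_const (ContinuousOn.log ?_
    fun x hx => (posDef_condOutputCov hx.2.1 hKw hx.1).det_pos.ne') _) continuousOn_const) _
  unfold condOutputCov
  exact Continuous.continuousOn (Continuous.matrix_det (by fun_prop))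

lemma rateReal_le_directedRateReal (hKw : Kw.PosDef) (hKv : Kv.PosDef)
    {x : Matrix (Fin n) (Fin n) ℝ × Matrix (Fin n) (Fin n) ℝ} (hx : x ∈ schemes Kw Kv P) :
    rateReal Kw Kv x ≤ directedRateReal Kw x := by
  have hA := posDef_unitLower_conj hKw hx.1
  have hN := posDef_noiseCov hKw hKv.posSemidef hx.1
  have hC := posDef_condOutputCov hx.2.1 hKw hx.1
  have hdet : ((1 + x.1) * Kw * (1 + x.1)ᵀ).det = Kw.det := by
    rw [det_mul, det_mul, det_transpose, det_one_add_of_isStrictlyLower hx.1, one_mul, mul_one]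
  have h := det_add_div_det_antitone hA (posSemidef_mul_mul_transpose hKv.posSemidef x.1) hx.2.1
  rw [hdet] at h
  rw [rateReal, directedRateReal, ← Real.logb_div hC.det_pos.ne' hKw.det_pos.ne']
  refine mul_le_mul_of_nonneg_left (Real.logb_le_logb_of_le one_lt_two ?_ h) (by positivity)
  exact div_pos (hN.posSemidef_add hx.2.1).det_pos hN.det_pos

end Maxima

end NoisyFeedback

/-! ### Assembly of the theorem. -/

open NoisyFeedback in
theorem theorem1 {n : ℕ} (hn : 0 < n) (Kw Kv : Matrix (Fin n) (Fin n) ℝ)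
    (hKw : Kw.PosDef) (hKv : Kv.PosDef) (P : ℝ) (hP : 0 ≤ P) :
    -- the program is a convex max-det program, with `log det` taken of positive definite matrices
    Convex ℝ (NoisyFeedback.feasible Kw Kv P) ∧
    (∀ p ∈ NoisyFeedback.feasible Kw Kv P, (NoisyFeedback.objectiveBlock Kv p.1 p.2).PosDef) ∧
    ConcaveOn ℝ (NoisyFeedback.feasible Kw Kv P) (NoisyFeedback.objective Kw Kv) ∧
    -- the three maxima are attained; the first is at most the second, which equals the third
    ∃ R C : ℝ≥0,
      IsGreatest (NoisyFeedback.achievableRates Kw Kv P) (R : ℝ≥0∞) ∧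
      IsGreatest (NoisyFeedback.directedRates Kw Kv P) (C : ℝ≥0∞) ∧
      IsGreatest (NoisyFeedback.objective Kw Kv '' NoisyFeedback.feasible Kw Kv P) (C : ℝ) ∧
      R ≤ C := by
  refine ⟨convex_feasible, fun p hp => ?_, concaveOn_objective hKw hKv, ?_⟩
  · have h := (mem_feasible_iff hKw hKv p.1 p.2).1 hp
    exact posDef_objectiveBlock hKw hKv h.1 h.2.1
  have hzero : ((0, 0) : Matrix (Fin n) (Fin n) ℝ × Matrix (Fin n) (Fin n) ℝ) ∈
      schemes Kw Kv P :=
    ⟨fun _ _ _ => rfl, PosSemidef.zero, by simpa using mul_nonneg n.cast_nonneg hP⟩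
  obtain ⟨x, hx, hxmax⟩ := (isCompact_schemes hKw hKv).exists_isMaxOn ⟨_, hzero⟩
    (continuousOn_rateReal hKw hKv)
  obtain ⟨y, hy, hymax⟩ := (isCompact_schemes hKw hKv).exists_isMaxOn ⟨_, hzero⟩
    (continuousOn_directedRateReal hKw)
  have hrate : ∀ z ∈ schemes Kw Kv P, rate z.1 z.2 Kw Kv = ENNReal.ofReal (rateReal Kw Kv z) :=
    fun z hz => rate_eq hn hz.2.1 hKw hKv.posSemidef hz.1
  have hdir : ∀ z ∈ schemes Kw Kv P,
      directedRate z.1 z.2 Kw Kv = ENNReal.ofReal (directedRateReal Kw z) :=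
    fun z hz => directedRate_eq hn hz.2.1 hKw hKv.posSemidef hz.1
  -- The zero scheme has directed rate zero, so the maximum is nonnegative and truncation by
  -- `Real.toNNReal` leaves it unchanged; the real-valued program needs this.
  have hy0 : 0 ≤ directedRateReal Kw y := by
    have h := hymax hzero
    simpa [directedRateReal, condOutputCov] using h
  have hcov : ∀ {B Ks : Matrix (Fin n) (Fin n) ℝ}, Ks.PosSemidef →
      inputCov B Ks Kw Kv = Ks + B * (Kw + Kv) * Bᵀ := fun hKs =>
    inputCov_eq hKs hKw.posSemidef hKv.posSemidef _
  refine ⟨(rateReal Kw Kv x).toNNReal, (directedRateReal Kw y).toNNReal, ⟨?_, ?_⟩, ⟨?_, ?_⟩,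
    ⟨?_, ?_⟩, ?_⟩
  · exact ⟨x.1, x.2, hx.1, hx.2.1, hx.2.2, (hrate x hx).symm⟩
  · rintro _ ⟨B, Ks, hB, hKs, htr, rfl⟩
    have hz : (B, Ks) ∈ schemes Kw Kv P := ⟨hB, hKs, htr⟩
    rw [hrate _ hz]
    exact ENNReal.ofReal_le_ofReal (hxmax hz)
  · exact ⟨y.1, y.2, hy.1, hy.2.1, by rw [hcov hy.2.1]; exact hy.2.2, (hdir y hy).symm⟩
  · rintro _ ⟨B, Ks, hB, hKs, htr, rfl⟩
    rw [hcov hKs] at htr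
    have hz : (B, Ks) ∈ schemes Kw Kv P := ⟨hB, hKs, htr⟩
    rw [hdir _ hz]
    exact ENNReal.ofReal_le_ofReal (hymax hz)
  · have hsub : (y.2 + noiseCov y.1 Kw Kv) - noiseCov y.1 Kw Kv = y.2 := add_sub_cancel_right _ _
    refine ⟨(y.2 + noiseCov y.1 Kw Kv, y.1), (mem_feasible_iff hKw hKv _ _).2 ?_, ?_⟩
    · rw [hsub]
      exact ⟨hy.1, hy.2.1, hy.2.2⟩
    · rw [objective_eq hKw hKv hy.1 (by rw [hsub]; exact hy.2.1), hsub, Real.coe_toNNReal _ hy0]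
      rfl
  · rintro _ ⟨⟨H, B⟩, hp, rfl⟩
    obtain ⟨hB, hKs, htr⟩ := (mem_feasible_iff hKw hKv H B).1 hp
    have hz : (B, H - noiseCov B Kw Kv) ∈ schemes Kw Kv P := ⟨hB, hKs, htr⟩
    rw [objective_eq hKw hKv hB hKs, Real.coe_toNNReal _ hy0]
    exact hymax hz
  · exact Real.toNNReal_le_toNNReal
      ((rateReal_le_directedRateReal hKw hKv hx).trans (hymax hx))

end
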